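/- Conventions. A weight function is a continuous nondecreasing function $\omega:[0,\infty)\to[0,\infty)$ with $\omega(0)=0$ and $\lim_{t\to\infty}\omega(t)=\infty$; it is normalized if $\omega=0$ on $[0,1]$. Condition $(\omega_3)$ means $\log t=o(\omega(t))$ as $t\to\infty$, and $(\omega_4)$ means that $t\mapsto\omega(e^t)$ is convex on $\mathbb R$. The growth index $\gamma(\omega)\in[0,\infty]$ is the supremum of all $\gamma>0$ for which there is $K>1$ with $\limsup_{t\to\infty}\omega(K^\gamma t)/\omega(t)<K$ (and $0$ if there is none). Put $\varphi^*_\omega(x)=\sup_{y\in\mathbb R}\,(xy-\omega(e^y))$ for $x\ge 0$. For a sequence $M=(M_p)_{p\in\mathbb N}$ of positive numbers put $\omega_M(t)=\sup_{p\in\mathbb N}\log(t^p/M_p)$ for $t>0$, and $\omega_M(0)=0$. For $\gamma>0$ let $S_\gamma=\{z:|\arg z|<\gamma\pi/2\}$ in the Riemann surface of the logarithm. For a normalized weight function $\omega$ with $(\omega_3)$ and $l>0$, let $\mathcal A_{\omega,l}(S_\gamma)$ be the space of holomorphic functions $f$ on $S_\gamma$ with $$\|f\|_{\omega,l}=\sup_{z\in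 S_\gamma,\,p\in\mathbb N}\frac{|f^{(p)}(z)|}{\exp(\frac1l\varphi^*_\omega(lp))}<\infty ,$$ and let $\Lambda_{\omega,l}$ be the space of complex sequences $\lambda=(\lambda_p)_{p\in\mathbb N}$ with $|\lambda|_{\omega,l}=\sup_{p}|\lambda_p|/\exp(\frac1l\varphi^*_\omega(lp))<\infty$, both with these norms; put $\mathcal A_{\{\omega\}}(S_\gamma)=\bigcup_{l>0}\mathcal A_{\omega,l}(S_\gamma)$. For a family $\mathcal M=\{M^x:x>0\}$ of sequences of positive numbers, let $\mathcal A_{\{\mathcal M\}}(S_\gamma)$ be the set of holomorphic functions $f$ on $S_\gamma$ such that $\sup_{z\in S_\gamma,\,p\in\mathbb N}|f^{(p)}(z)|/(h^pM^x_p)<\infty$ for some $x,h>0$. The Borel map is $\mathcal B(f)=(f^{(p)}(0))_{p\in\mathbb N}$ with $f^{(p)}(0)=\lim_{z\to 0,\,z\in S_\gamma}f^{(p)}(z)$. Statement. Let $\tau$ be a normalized weight function with $(\omega_3)$, $(\omega_4)$ and $\gamma(\tau)>0$, and let $0<\gamma<\gamma(\tau)$. Put $T^x_p=\exp(\frac1x\varphi^*_\tau(xp))$,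 $\widehat T^x_p=p!\,T^x_p$ and $\widehat{\mathcal T}=\{\widehat T^x:x>0\}$. Let $\omega=\omega_{\widehat T^x}$ for some $x>0$. Then $\mathcal A_{\{\widehat{\mathcal T}\}}(S_\gamma)=\mathcal A_{\{\omega\}}(S_\gamma)$, and for every $l>0$ there exist $l_1>0$ and a continuous linear map $$\lambda\in\Lambda_{\omega,l}\longmapsto f_\lambda\in\mathcal A_{\omega,l_1}(S_\gamma)$$ such that $\mathcal B(f_\lambda)=\lambda$ for every $\lambda\in\Lambda_{\omega,l}$. -/

import Mathlib

open Filter Topology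
open scoped ENNReal Nat

noncomputable section

namespace Ultraholomorphic

/-! ### Weight functions

A weight function lives on `[0, ∞)`; it is represented by a function `ℝ → ℝ` of which only the values
on `[0, ∞)` matter. -/

/-- Weight functions: continuous, nondecreasing on `[0, ∞)`, zero at `0`, tending to infinity
(nonnegativity follows). -/
structure IsWeight (ω : ℝ → ℝ) : Prop where
  continuousOn : ContinuousOn ω (Set.Ici 0)
  monotoneOn : MonotoneOn ω (Set.Ici 0)
  map_zero : ω 0 = 0
  tendsto_atTop : Tendsto ω atTop atTop

/-- Normalized weights: weights vanishing on `[0, 1]`. -/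
structure IsNormalizedWeight (ω : ℝ → ℝ) : Prop extends IsWeight ω where
  eq_zero_of_mem : ∀ t ∈ Set.Icc (0 : ℝ) 1, ω t = 0

/-- Condition `(ω₃)`: `log t = o(ω t)` as `t → ∞`. -/
def Omega3 (ω : ℝ → ℝ) : Prop := Real.log =o[atTop] ω

/-- Condition `(ω₄)`: `t ↦ ω (exp t)` is convex on `ℝ`. -/
def Omega4 (ω : ℝ → ℝ) : Prop := ConvexOn ℝ Set.univ (fun t : ℝ => ω (Real.exp t))

/-- The property `(P_{ω,γ})`: there is `K > 1` with `limsup_{t → ∞} ω (K ^ γ t) / ω t < K`.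
The limsup is taken in `[0, ∞]`, so it is the honest one also for unbounded quotients. -/
def GrowthProperty (ω : ℝ → ℝ) (γ : ℝ) : Prop :=
  ∃ K : ℝ, 1 < K ∧
    limsup (fun t : ℝ => ENNReal.ofReal (ω (K ^ γ * t) / ω t)) atTop < ENNReal.ofReal K

/-- The growth index `γ(ω) ∈ [0, ∞]`, the supremum of all `γ > 0` with `(P_{ω,γ})`
(equal to `0` if there is none). -/
def growthIndex (ω : ℝ → ℝ) : ℝ≥0∞ :=
  ⨆ (γ : ℝ) (_ : 0 < γ ∧ GrowthProperty ω γ), ENNReal.ofReal γ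

/-- The Legendre-Fenchel-Young conjugate `φ*_ω(x) = sup_y (x y - ω (exp y))`. -/
def youngConj (ω : ℝ → ℝ) (x : ℝ) : ℝ := ⨆ y : ℝ, (x * y - ω (Real.exp y))

/-! ### Weight sequences and the associated function -/

/-- The weight matrix associated with `ω`: `W^l_p = exp (φ*_ω(l p) / l)`. -/
def weightMatrix (ω : ℝ → ℝ) (l : ℝ) (p : ℕ) : ℝ :=
  Real.exp (1 / l * youngConj ω (l * p))

/-- The matrix `T̂` obtained from the weight matrix `T` of `τ`: `T̂^x_p = p! T^x_p`. -/
def hatMatrix (τ : ℝ → ℝ) (x : ℝ) (p : ℕ) : ℝ := (p ! : ℝ) * weightMatrix τ x p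

/-- The function associated with a sequence `M`: `ω_M(t) = sup_p log (t ^ p / M_p)` for `t > 0`,
and `ω_M(0) = 0`. -/
def assocFun (M : ℕ → ℝ) (t : ℝ) : ℝ :=
  if 0 < t then ⨆ p : ℕ, Real.log (t ^ p / M p) else 0

/-! ### Sectors of the Riemann surface of the logarithm -/

/-- The Riemann surface of the logarithm, in its global holomorphic coordinate `w = log z`: the
complex number `w` stands for the point `z` with `|z| = exp (re w)` and `arg z = im w`, and the
projection to `ℂ \ {0}` is `w ↦ exp w`. -/
abbrev LogSurface : Type := ℂ

/-- The modulus `|z|` of a point of the surface. -/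
def LogSurface.modulus (w : LogSurface) : ℝ := Real.exp w.re

/-- The argument `arg z` of a point of the surface. -/
def LogSurface.argument (w : LogSurface) : ℝ := w.im

/-- The unbounded sector `S_γ = {z : |arg z| < γ π / 2}`. -/
def sector (γ : ℝ) : Set LogSurface := {w | |LogSurface.argument w| < γ * Real.pi / 2}

/-- Extension by zero of a function on a sector. The sector being open, derivatives at its points
do not see the values outside. -/
def extendZero {γ : ℝ} (f : sector γ → ℂ) : LogSurface → ℂ :=
  open Classical in fun w => if h : w ∈ sector γ then f ⟨w, h⟩ else 0

/-- Holomorphic functions on the sector. -/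
def IsHolo {γ : ℝ} (f : sector γ → ℂ) : Prop := DifferentiableOn ℂ (extendZero f) (sector γ)

/-- The derivative `d/dz` on the surface: as `z = exp w`, one has `d/dz = exp (-w) d/dw`. -/
def surfaceDeriv (F : LogSurface → ℂ) : LogSurface → ℂ := fun w => Complex.exp (-w) * deriv F w

/-- The derivative `f^{(p)} = d^p f / dz^p` of a function on a sector. -/
def iterDeriv {γ : ℝ} (p : ℕ) (f : sector γ → ℂ) : sector γ → ℂ :=
  fun w => (surfaceDeriv^[p] (extendZero f)) w

/-- The filter `z → 0`, `z ∈ S_γ`. -/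
def atVertex (γ : ℝ) : Filter (sector γ) :=
  comap (fun w : sector γ => LogSurface.modulus w) (𝓝 0)

/-- `B(f) = a` for the Borel map `B`, i.e. `lim_{z → 0, z ∈ S_γ} f^{(p)}(z)` exists and equals `a_p`
for every `p`. -/
def HasBorelImage {γ : ℝ} (f : sector γ → ℂ) (a : ℕ → ℂ) : Prop :=
  ∀ p : ℕ, Tendsto (iterDeriv p f) (atVertex γ) (𝓝 (a p))

/-! Linearity of the derivatives on holomorphic functions. -/

lemma isOpen_sector (γ : ℝ) : IsOpen (sector γ) :=
  isOpen_lt (Complex.continuous_im.abs) continuous_const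

lemma extendZero_apply {γ : ℝ} (f : sector γ → ℂ) (w : sector γ) : extendZero f w = f w := by
  simp [extendZero]

lemma extendZero_add {γ : ℝ} (f g : sector γ → ℂ) :
    extendZero (f + g) = extendZero f + extendZero g := by
  funext w
  by_cases h : w ∈ sector γ <;> simp [extendZero, h]

lemma extendZero_smul {γ : ℝ} (c : ℂ) (f : sector γ → ℂ) :
    extendZero (c • f) = c • extendZero f := by
  funext w
  by_cases h : w ∈ sector γ <;> simp [extendZero, h]

lemma extendZero_zero {γ : ℝ} : extendZero (0 : sector γ → ℂ) = 0 := by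
  funext w
  by_cases h : w ∈ sector γ <;> simp [extendZero, h]

lemma differentiableOn_surfaceDeriv {γ : ℝ} {F : LogSurface → ℂ}
    (hF : DifferentiableOn ℂ F (sector γ)) : DifferentiableOn ℂ (surfaceDeriv F) (sector γ) :=
  (Complex.differentiable_exp.comp differentiable_neg).differentiableOn.mul
    (hF.deriv (isOpen_sector γ))

lemma differentiableOn_iterate {γ : ℝ} {F : LogSurface → ℂ}
    (hF : DifferentiableOn ℂ F (sector γ)) (p : ℕ) :
    DifferentiableOn ℂ (surfaceDeriv^[p] F) (sector γ) := by
  induction p with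
  | zero => exact hF
  | succ p ih =>
    rw [Function.iterate_succ_apply']
    exact differentiableOn_surfaceDeriv ih

lemma iterate_add_on {γ : ℝ} {F G : LogSurface → ℂ} (hF : DifferentiableOn ℂ F (sector γ))
    (hG : DifferentiableOn ℂ G (sector γ)) (p : ℕ) :
    Set.EqOn (surfaceDeriv^[p] (F + G)) (surfaceDeriv^[p] F + surfaceDeriv^[p] G) (sector γ) := by
  induction p with
  | zero => intro w _; rfl
  | succ p ih =>
    intro w hw
    have hn := (isOpen_sector γ).mem_nhds hw
    have h1 := ((differentiableOn_iterate hF p).differentiableAt hn)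
    have h2 := ((differentiableOn_iterate hG p).differentiableAt hn)
    have h3 := (ih.eventuallyEq_of_mem hn).deriv_eq
    simp only [Function.iterate_succ_apply', Pi.add_apply, surfaceDeriv]
    rw [h3, deriv_add h1 h2, mul_add]

lemma iterate_smul (c : ℂ) (F : LogSurface → ℂ) (p : ℕ) :
    surfaceDeriv^[p] (c • F) = c • surfaceDeriv^[p] F := by
  induction p with
  | zero => rfl
  | succ p ih =>
    simp only [Function.iterate_succ_apply', ih]
    funext w
    simp only [surfaceDeriv, Pi.smul_apply, smul_eq_mul, deriv_const_smul_field]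
    ring

lemma iterDeriv_zero_apply {γ : ℝ} (f : sector γ → ℂ) (w : sector γ) : iterDeriv 0 f w = f w :=
  extendZero_apply f w

lemma iterDeriv_add {γ : ℝ} {f g : sector γ → ℂ} (hf : IsHolo f) (hg : IsHolo g) (p : ℕ)
    (w : sector γ) : iterDeriv p (f + g) w = iterDeriv p f w + iterDeriv p g w := by
  simp only [iterDeriv, extendZero_add]
  exact iterate_add_on hf hg p w.2

lemma iterDeriv_smul {γ : ℝ} (c : ℂ) (f : sector γ → ℂ) (p : ℕ) (w : sector γ) :
    iterDeriv p (c • f) w = c * iterDeriv p f w := by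
  simp only [iterDeriv, extendZero_smul, iterate_smul]
  rfl

/-! ### Ultraholomorphic classes and sequence spaces -/

/-- The functions `f` holomorphic in `S_γ` with `|f^{(p)}(z)| ≤ C v_p` for some `C`
and all `z ∈ S_γ`, `p ∈ ℕ`; for a positive sequence `v` this says
`sup_{z, p} |f^{(p)}(z)| / v_p < ∞`. -/
def holoBounded (γ : ℝ) (v : ℕ → ℝ) : Submodule ℂ (sector γ → ℂ) where
  carrier := {f | IsHolo f ∧ ∃ C : ℝ, ∀ (w : sector γ) (p : ℕ), ‖iterDeriv p f w‖ ≤ C * v p}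
  zero_mem' := by
    have h0 : IsHolo (0 : sector γ → ℂ) := by
      unfold IsHolo
      rw [extendZero_zero]
      exact differentiableOn_const 0
    refine ⟨h0, 0, fun w p => ?_⟩
    have h := iterDeriv_smul (γ := γ) 0 0 p w
    rw [zero_smul, zero_mul] at h
    simp [h]
  add_mem' := by
    rintro f g ⟨hf, C, hC⟩ ⟨hg, D, hD⟩
    refine ⟨?_, C + D, fun w p => ?_⟩
    · unfold IsHolo
      rw [extendZero_add]
      exact hf.add hg
    · rw [iterDeriv_add hf hg, add_mul]
      exact (norm_add_le _ _).trans (add_le_add (hC w p) (hD w p))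
  smul_mem' := by
    rintro c f ⟨hf, C, hC⟩
    refine ⟨?_, ‖c‖ * C, fun w p => ?_⟩
    · unfold IsHolo
      rw [extendZero_smul]
      exact hf.const_smul c
    · rw [iterDeriv_smul, norm_mul, mul_assoc]
      exact mul_le_mul_of_nonneg_left (hC w p) (norm_nonneg c)

/-- The complex sequences `a` with `|a_p| ≤ C v_p` for some `C` and all `p ∈ ℕ`; for a positive
sequence `v` this says `sup_p |a_p| / v_p < ∞`. -/
def seqBounded (v : ℕ → ℝ) : Submodule ℂ (ℕ → ℂ) where
  carrier := {a | ∃ C : ℝ, ∀ p : ℕ, ‖a p‖ ≤ C * v p}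
  zero_mem' := ⟨0, fun p => by simp⟩
  add_mem' := by
    rintro a b ⟨C, hC⟩ ⟨D, hD⟩
    refine ⟨C + D, fun p => ?_⟩
    rw [add_mul]
    exact (norm_add_le _ _).trans (add_le_add (hC p) (hD p))
  smul_mem' := by
    rintro c a ⟨C, hC⟩
    refine ⟨‖c‖ * C, fun p => ?_⟩
    rw [Pi.smul_apply, norm_smul, mul_assoc]
    exact mul_le_mul_of_nonneg_left (hC p) (norm_nonneg c)

/-- The class `A_{M}(S_γ)` of a weight matrix `M = {M^x : x > 0}`: the union over `x, h > 0` of the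
spaces `A_{M^x,h}(S_γ)` given by `sup_{z, p} |f^{(p)}(z)| / (h ^ p M^x_p) < ∞`. -/
def classOfMatrix (γ : ℝ) (M : ℝ → ℕ → ℝ) : Set (sector γ → ℂ) :=
  {f | ∃ x : ℝ, 0 < x ∧ ∃ h : ℝ, 0 < h ∧ f ∈ holoBounded γ (fun p => h ^ p * M x p)}

/-- The class `A_{ω}(S_γ)`: the union over `l > 0` of the spaces `A_{ω,l}(S_γ)`. -/
def classOfWeight (γ : ℝ) (ω : ℝ → ℝ) : Set (sector γ → ℂ) :=
  {f | ∃ l : ℝ, 0 < l ∧ f ∈ holoBounded γ (weightMatrix ω l)}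

/-- The space `A_{ω,l}(S_γ)` of holomorphic functions with
`sup_{z, p} |f^{(p)}(z)| / exp (φ*_ω(l p) / l) < ∞`. It is a type of its own, so that it carries
its norm and not the topology of pointwise convergence. -/
def HoloSpace (γ : ℝ) (ω : ℝ → ℝ) (l : ℝ) : Type := holoBounded γ (weightMatrix ω l)

/-- The space `Λ_{ω,l}` of sequences with `sup_p |a_p| / exp (φ*_ω(l p) / l) < ∞`. -/
def SeqSpace (ω : ℝ → ℝ) (l : ℝ) : Type := seqBounded (weightMatrix ω l)

lemma weightMatrix_pos (ω : ℝ → ℝ) (l : ℝ) (p : ℕ) : 0 < weightMatrix ω l p := Real.exp_pos _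

namespace HoloSpace

variable {γ : ℝ} {ω : ℝ → ℝ} {l : ℝ}

instance : AddCommGroup (HoloSpace γ ω l) :=
  inferInstanceAs (AddCommGroup (holoBounded γ (weightMatrix ω l)))

instance : Module ℂ (HoloSpace γ ω l) :=
  inferInstanceAs (Module ℂ (holoBounded γ (weightMatrix ω l)))

/-- The underlying function on the sector. -/
def toFun (f : HoloSpace γ ω l) : sector γ → ℂ := Subtype.val f

/-- The norm `‖f‖_{ω,l} = sup_{z, p} |f^{(p)}(z)| / exp (φ*_ω(l p) / l)`. -/
instance : Norm (HoloSpace γ ω l) :=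
  ⟨fun f => ⨆ q : sector γ × ℕ, ‖iterDeriv q.2 f.toFun q.1‖ / weightMatrix ω l q.2⟩

lemma norm_def (f : HoloSpace γ ω l) :
    ‖f‖ = ⨆ q : sector γ × ℕ, ‖iterDeriv q.2 f.toFun q.1‖ / weightMatrix ω l q.2 := rfl

lemma isHolo (f : HoloSpace γ ω l) : IsHolo f.toFun := (Subtype.property f).1

lemma bddAbove (f : HoloSpace γ ω l) :
    BddAbove (Set.range fun q : sector γ × ℕ =>
      ‖iterDeriv q.2 f.toFun q.1‖ / weightMatrix ω l q.2) := by
  obtain ⟨C, hC⟩ := (Subtype.property f).2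
  refine ⟨C, ?_⟩
  rintro _ ⟨q, rfl⟩
  exact (div_le_iff₀ (weightMatrix_pos ω l q.2)).2 (hC q.1 q.2)

lemma core : NormedSpace.Core ℂ (HoloSpace γ ω l) where
  norm_nonneg f := Real.iSup_nonneg fun q => div_nonneg (norm_nonneg _) (weightMatrix_pos _ _ _).le
  norm_smul c f := by
    rw [norm_def, norm_def, Real.mul_iSup_of_nonneg (norm_nonneg c)]
    refine iSup_congr fun q => ?_
    have h : iterDeriv q.2 (toFun (c • f)) q.1 = c * iterDeriv q.2 (toFun f) q.1 :=
      iterDeriv_smul c (toFun f) q.2 q.1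
    rw [h, norm_mul, mul_div_assoc]
  norm_triangle f g := by
    refine Real.iSup_le (fun q => ?_) (add_nonneg
      (Real.iSup_nonneg fun q => div_nonneg (norm_nonneg _) (weightMatrix_pos _ _ _).le)
      (Real.iSup_nonneg fun q => div_nonneg (norm_nonneg _) (weightMatrix_pos _ _ _).le))
    have h : iterDeriv q.2 (toFun (f + g)) q.1
        = iterDeriv q.2 (toFun f) q.1 + iterDeriv q.2 (toFun g) q.1 :=
      iterDeriv_add f.isHolo g.isHolo q.2 q.1
    rw [h]
    refine (div_le_div_of_nonneg_right (norm_add_le _ _) (weightMatrix_pos _ _ _).le).trans ?_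
    rw [add_div]
    exact add_le_add (le_ciSup f.bddAbove q) (le_ciSup g.bddAbove q)
  norm_eq_zero_iff f := by
    constructor
    · intro h
      refine Subtype.ext (funext fun w => ?_)
      have h1 := le_ciSup f.bddAbove (w, 0)
      rw [← norm_def, h] at h1
      have h2 : ‖iterDeriv 0 f.toFun w‖ ≤ 0 := by
        have := (div_le_iff₀ (weightMatrix_pos ω l 0)).1 h1
        simpa using this
      rw [iterDeriv_zero_apply] at h2
      exact norm_le_zero_iff.1 h2
    · rintro rfl
      have h (q : sector γ × ℕ) : iterDeriv q.2 (toFun (0 : HoloSpace γ ω l)) q.1 = 0 := by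
        have h := iterDeriv_smul (γ := γ) 0 0 q.2 q.1
        rw [zero_smul, zero_mul] at h
        exact h
      simp [norm_def, h]

instance : NormedAddCommGroup (HoloSpace γ ω l) := NormedAddCommGroup.ofCore core

instance : NormedSpace ℂ (HoloSpace γ ω l) := NormedSpace.ofCore core

end HoloSpace

namespace SeqSpace

variable {ω : ℝ → ℝ} {l : ℝ}

instance : AddCommGroup (SeqSpace ω l) :=
  inferInstanceAs (AddCommGroup (seqBounded (weightMatrix ω l)))

instance : Module ℂ (SeqSpace ω l) :=
  inferInstanceAs (Module ℂ (seqBounded (weightMatrix ω l)))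

/-- The underlying sequence. -/
def toFun (a : SeqSpace ω l) : ℕ → ℂ := Subtype.val a

/-- The norm `|a|_{ω,l} = sup_p |a_p| / exp (φ*_ω(l p) / l)`. -/
instance : Norm (SeqSpace ω l) := ⟨fun a => ⨆ p : ℕ, ‖a.toFun p‖ / weightMatrix ω l p⟩

lemma norm_def (a : SeqSpace ω l) : ‖a‖ = ⨆ p : ℕ, ‖a.toFun p‖ / weightMatrix ω l p := rfl

lemma bddAbove (a : SeqSpace ω l) :
    BddAbove (Set.range fun p : ℕ => ‖a.toFun p‖ / weightMatrix ω l p) := by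
  obtain ⟨C, hC⟩ := Subtype.property a
  refine ⟨C, ?_⟩
  rintro _ ⟨p, rfl⟩
  exact (div_le_iff₀ (weightMatrix_pos ω l p)).2 (hC p)

lemma core : NormedSpace.Core ℂ (SeqSpace ω l) where
  norm_nonneg a := Real.iSup_nonneg fun p => div_nonneg (norm_nonneg _) (weightMatrix_pos _ _ _).le
  norm_smul c a := by
    rw [norm_def, norm_def, Real.mul_iSup_of_nonneg (norm_nonneg c)]
    refine iSup_congr fun p => ?_
    have h : toFun (c • a) p = c * toFun a p := rfl
    rw [h, norm_mul, mul_div_assoc]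
  norm_triangle a b := by
    refine ciSup_le fun p => ?_
    have h : toFun (a + b) p = toFun a p + toFun b p := rfl
    rw [h]
    refine (div_le_div_of_nonneg_right (norm_add_le _ _) (weightMatrix_pos _ _ _).le).trans ?_
    rw [add_div]
    exact add_le_add (le_ciSup a.bddAbove p) (le_ciSup b.bddAbove p)
  norm_eq_zero_iff a := by
    constructor
    · intro h
      refine Subtype.ext (funext fun p => ?_)
      have h1 := le_ciSup a.bddAbove p
      rw [← norm_def, h] at h1
      have h2 : ‖a.toFun p‖ ≤ 0 := by
        have := (div_le_iff₀ (weightMatrix_pos ω l p)).1 h1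
        simpa using this
      exact norm_le_zero_iff.1 h2
    · rintro rfl
      have h (p : ℕ) : toFun (0 : SeqSpace ω l) p = 0 := rfl
      simp [norm_def, h]

instance : NormedAddCommGroup (SeqSpace ω l) := NormedAddCommGroup.ofCore core

instance : NormedSpace ℂ (SeqSpace ω l) := NormedSpace.ofCore core

end SeqSpace

end Ultraholomorphic

end

noncomputable section

namespace Ultraholomorphic

/-! ### Weight matrices -/

/-! Everything rests on `T^y_p = sup_{t > 0} t^p exp (-τ t / y)`.

Equality of the classes: the two matrices dominate each other up to geometric factors and a change
of parameter. In one direction, `ω` is tested on the exponent `L p` with an integer `L ≥ l`; since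
`(T^x_{Lp})^{1/L} = T^{xL}_p` and `((L p)!)^{1/L} ≤ (L e)^p p!`, the matrix of `ω` is bounded by
`T̂` (`exists_weightMatrix_assocFun_le`). In the other, `r^p ≤ p! exp r` gives `ω t ≤ r + τ (t / r)
/ x` for every `r > 0`, and taking `r` of order `l p` recovers the factorial
(`exists_hatMatrix_le`).

Extension: put `a_p = λ_p / p!`, which is at most a constant times `h^p T^y_p`, and sum `a_p z^p
χ_p(b z)`, with holomorphic cutoffs `χ_p` that do not depend on `λ`, so that the sum is linear in
`λ`. Let `t_p` nearly attain the supremum defining `T^y_p`. The cutoff has to be close to `1` for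
`|z|` well below `1 / t_p` and small beyond, with errors measured by `T^{y₁}_N |z|^N` for every `N`
(`FlatData.exists_cutoffs`).

It is the composition of two functions. The exponent `H_t` takes values in a cone about the positive
axis, satisfies `Re H_t ≥ c/2 (τ(1/|z|) - τ t)` for `|z| ≤ 1/t`, and is `O((τ t + 1) (t|z|)^{-a})`.
The normalized incomplete gamma function of order `m p` vanishes to that order at `0`, which beats
`z^p` far out, and tends to `1` exponentially in the cone. The growth index enters through `H_t`: as
`γ < γ(τ)`, there is an `a` with `z^a` in a cone on a sector wider than `S_γ`, while `τ` still grows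
more slowly than the power `a`, so that the series for `H_t` converges.

The sum then has remainders of order `N` bounded by `b^N T^{y₁}_N |z|^N` on the wider sector. Cauchy
estimates on `S_γ` supply the factor `n!`, hence bounds by `T̂^{y₁}`, which the first part turns
into bounds by the matrix of `ω`; the expansion at the vertex identifies the Borel image. -/

lemma IsWeight.nonneg {τ : ℝ → ℝ} (h : IsWeight τ) {t : ℝ} (ht : 0 ≤ t) : 0 ≤ τ t := by
  have := h.monotoneOn (Set.mem_Ici.2 le_rfl) (Set.mem_Ici.2 ht) ht
  rwa [h.map_zero] at this

lemma bddAbove_youngConj {τ : ℝ → ℝ} (h : IsWeight τ) (h3 : Omega3 τ) {s : ℝ} (hs : 0 ≤ s) :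
    BddAbove (Set.range fun y : ℝ => s * y - τ (Real.exp y)) := by
  have hb := h3.bound (show (0 : ℝ) < 1 / (s + 1) by positivity)
  obtain ⟨T, hT⟩ := eventually_atTop.1 hb
  refine ⟨s * Real.log (max T 1), ?_⟩
  rintro _ ⟨y, rfl⟩
  have hY : 0 ≤ Real.log (max T 1) := Real.log_nonneg (le_max_right _ _)
  have hτ : 0 ≤ τ (Real.exp y) := h.nonneg (Real.exp_pos y).le
  rcases le_total (Real.log (max T 1)) y with hy | hy
  · have h1 : max T 1 ≤ Real.exp y :=
      (Real.log_le_iff_le_exp (lt_of_lt_of_le one_pos (le_max_right _ _))).1 hy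
    have h2 := hT _ ((le_max_left _ _).trans h1)
    rw [Real.log_exp, Real.norm_eq_abs, Real.norm_eq_abs, abs_of_nonneg hτ,
      abs_of_nonneg (hY.trans hy), one_div, inv_mul_eq_div, le_div_iff₀ (by positivity)] at h2
    have : 0 ≤ s * Real.log (max T 1) := mul_nonneg hs hY
    dsimp only
    nlinarith [hY.trans hy]
  · have := mul_le_mul_of_nonneg_left hy hs
    dsimp only
    linarith

lemma le_youngConj {τ : ℝ → ℝ} (h : IsWeight τ) (h3 : Omega3 τ) {s t : ℝ} (hs : 0 ≤ s)
    (ht : 0 < t) : s * Real.log t - τ t ≤ youngConj τ s := by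
  have := le_ciSup (bddAbove_youngConj h h3 hs) (Real.log t)
  rwa [Real.exp_log ht] at this

lemma pow_mul_exp_le_weightMatrix {τ : ℝ → ℝ} (h : IsWeight τ) (h3 : Omega3 τ) {y t : ℝ}
    (hy : 0 < y) (ht : 0 < t) (p : ℕ) :
    t ^ p * Real.exp (-(τ t / y)) ≤ weightMatrix τ y p := by
  have h1 := le_youngConj h h3 (s := y * p) (by positivity) ht
  have h2 : t ^ p = Real.exp (p * Real.log t) := by
    rw [Real.exp_nat_mul, Real.exp_log ht]
  rw [h2, ← Real.exp_add, weightMatrix, Real.exp_le_exp]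
  calc p * Real.log t + -(τ t / y) = 1 / y * (y * p * Real.log t - τ t) := by field_simp; ring
    _ ≤ _ := mul_le_mul_of_nonneg_left h1 (by positivity)

lemma exists_weightMatrix_le {τ : ℝ → ℝ} (h : IsNormalizedWeight τ) {y : ℝ} (hy : 0 < y) (p : ℕ) :
    ∃ t : ℝ, 1 ≤ t ∧ weightMatrix τ y p ≤ 2 * (t ^ p * Real.exp (-(τ t / y))) := by
  -- The supremum need not be attained; a loss of `y log 2` becomes the factor `2` after division by
  -- `y` and exponentiation.
  have h1 : youngConj τ (y * p) - y * Real.log 2 < youngConj τ (y * p) := by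
    have := Real.log_pos (one_lt_two)
    nlinarith
  obtain ⟨u, hu⟩ := exists_lt_of_lt_ciSup h1
  -- As `τ` vanishes at `1`, the point `0` does at least as well as any negative `u`.
  have h2 : ∃ v : ℝ, 0 ≤ v ∧ youngConj τ (y * p) - y * Real.log 2 < y * p * v - τ (Real.exp v) := by
    rcases le_total 0 u with h0 | h0
    · exact ⟨u, h0, hu⟩
    · refine ⟨0, le_rfl, hu.trans_le ?_⟩
      have h3 := h.nonneg (Real.exp_pos u).le
      have h4 : τ (Real.exp 0) = 0 := h.eq_zero_of_mem _ (by simp)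
      have : 0 ≤ y * p := by positivity
      rw [h4]
      nlinarith
  obtain ⟨v, hv0, hv⟩ := h2
  refine ⟨Real.exp v, Real.one_le_exp hv0, ?_⟩
  have h3 : 2 * (Real.exp v ^ p * Real.exp (-(τ (Real.exp v) / y)))
      = Real.exp (Real.log 2 + (p * v - τ (Real.exp v) / y)) := by
    rw [Real.exp_add, Real.exp_log two_pos, sub_eq_add_neg, Real.exp_add, Real.exp_nat_mul]
  rw [h3, weightMatrix, Real.exp_le_exp]
  calc 1 / y * youngConj τ (y * p)
      ≤ 1 / y * (y * Real.log 2 + (y * p * v - τ (Real.exp v))) :=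
        mul_le_mul_of_nonneg_left (by linarith) (by positivity)
    _ = _ := by field_simp

lemma weightMatrix_mono {τ : ℝ → ℝ} (h : IsWeight τ) (h3 : Omega3 τ) {y y' : ℝ} (hy : 0 < y)
    (hyy : y ≤ y') (p : ℕ) : weightMatrix τ y p ≤ weightMatrix τ y' p := by
  have hy' := hy.trans_le hyy
  rw [weightMatrix, weightMatrix, Real.exp_le_exp, one_div_mul_eq_div, div_le_iff₀ hy]
  refine ciSup_le fun u => ?_
  have h1 := le_youngConj h h3 (s := y' * p) (by positivity) (Real.exp_pos u)
  rw [Real.log_exp] at h1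
  have h2 : 0 ≤ τ (Real.exp u) := h.nonneg (Real.exp_pos u).le
  have h4 : (y' * p * u - τ (Real.exp u)) * (y / y') ≤ youngConj τ (y' * p) * (y / y') :=
    mul_le_mul_of_nonneg_right h1 (by positivity)
  have h5 : τ (Real.exp u) * (y / y') ≤ τ (Real.exp u) :=
    mul_le_of_le_one_right h2 ((div_le_one hy').2 hyy)
  have h6 : y' * p * u * (y / y') = y * p * u := by field_simp
  calc y * p * u - τ (Real.exp u) ≤ youngConj τ (y' * p) * (y / y') := by
        rw [sub_mul, h6] at h4; linarith
    _ = 1 / y' * youngConj τ (y' * p) * y := by ring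

lemma hatMatrix_pos (τ : ℝ → ℝ) (x : ℝ) (p : ℕ) : 0 < hatMatrix τ x p :=
  mul_pos (by positivity) (weightMatrix_pos τ x p)

/-- Splitting `t = r (t / r)` lets `p!` absorb `r^p` at the cost `exp r` and `T^x_p` absorb `(t /
r)^p`. The parameter `r` stays free, to be chosen according to the exponent at which `ω` is tested.
-/
lemma log_term_le {τ : ℝ → ℝ} (h : IsWeight τ) (h3 : Omega3 τ) {x t r : ℝ} (hx : 0 < x)
    (ht : 0 < t) (hr : 0 < r) (p : ℕ) :
    Real.log (t ^ p / hatMatrix τ x p) ≤ r + τ (t / r) / x := by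
  rw [Real.log_le_iff_le_exp (div_pos (pow_pos ht p) (hatMatrix_pos τ x p)),
    div_le_iff₀ (hatMatrix_pos τ x p), hatMatrix]
  have h1 : r ^ p ≤ p ! * Real.exp r := by
    have := Real.pow_div_factorial_le_exp r hr.le p
    rwa [div_le_iff₀ (by positivity), mul_comm] at this
  have h2 := pow_mul_exp_le_weightMatrix h h3 hx (div_pos ht hr) p
  calc t ^ p = r ^ p * ((t / r) ^ p * Real.exp (-(τ (t / r) / x))) * Real.exp (τ (t / r) / x) := by
        rw [mul_assoc, mul_assoc, ← Real.exp_add, neg_add_cancel, Real.exp_zero, mul_one, ← mul_pow,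
          mul_div_cancel₀ _ hr.ne']
    _ ≤ (p ! * Real.exp r) * weightMatrix τ x p * Real.exp (τ (t / r) / x) := by gcongr
    _ = _ := by rw [Real.exp_add]; ring

lemma assocFun_le {τ : ℝ → ℝ} (h : IsWeight τ) (h3 : Omega3 τ) {x t r : ℝ} (hx : 0 < x)
    (ht : 0 < t) (hr : 0 < r) : assocFun (hatMatrix τ x) t ≤ r + τ (t / r) / x := by
  rw [assocFun, if_pos ht]
  exact ciSup_le fun p => log_term_le h h3 hx ht hr p

lemma le_assocFun {τ : ℝ → ℝ} (h : IsWeight τ) (h3 : Omega3 τ) {x t : ℝ} (hx : 0 < x)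
    (ht : 0 < t) (p : ℕ) :
    p * Real.log t - Real.log (hatMatrix τ x p) ≤ assocFun (hatMatrix τ x) t := by
  rw [assocFun, if_pos ht]
  have hb : BddAbove (Set.range fun p : ℕ => Real.log (t ^ p / hatMatrix τ x p)) := by
    refine ⟨1 + τ (t / 1) / x, ?_⟩
    rintro _ ⟨p, rfl⟩
    exact log_term_le h h3 hx ht one_pos p
  have := le_ciSup hb p
  rwa [Real.log_div (pow_pos ht p).ne' (hatMatrix_pos τ x p).ne', Real.log_pow] at this

lemma weightMatrix_zero {τ : ℝ → ℝ} (h : IsNormalizedWeight τ) (h3 : Omega3 τ) (x : ℝ) :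
    weightMatrix τ x 0 = 1 := by
  have h0 : youngConj τ 0 = 0 := by
    refine le_antisymm (ciSup_le fun u => ?_) ?_
    · have := h.nonneg (Real.exp_pos u).le
      linarith
    · have := le_youngConj h.toIsWeight h3 le_rfl (one_pos (α := ℝ))
      rw [h.eq_zero_of_mem 1 (by simp)] at this
      simpa using this
  simp [weightMatrix, h0]

lemma assocFun_nonneg {τ : ℝ → ℝ} (h : IsNormalizedWeight τ) (h3 : Omega3 τ) {x t : ℝ} (hx : 0 < x)
    (ht : 0 < t) : 0 ≤ assocFun (hatMatrix τ x) t := by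
  have := le_assocFun h.toIsWeight h3 hx ht 0
  simpa [hatMatrix, weightMatrix_zero h h3] using this

/-- The associated function sees only integer exponents, so `l p` is rounded up to `L p`. Rescaling
by `l / L ≤ 1` is harmless because the associated function is nonnegative. -/
lemma mul_sub_assocFun_le {τ : ℝ → ℝ} (h : IsNormalizedWeight τ) (h3 : Omega3 τ) {x l : ℝ}
    (hx : 0 < x) (hl : 0 < l) {L : ℕ} (hL : l ≤ L) (p : ℕ) (u : ℝ) :
    l * p * u - assocFun (hatMatrix τ x) (Real.exp u)
      ≤ l / L * Real.log (hatMatrix τ x (L * p)) := by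
  have hL0 : (0 : ℝ) < L := hl.trans_le hL
  have h1 := le_assocFun h.toIsWeight h3 hx (Real.exp_pos u) (L * p)
  have h2 := assocFun_nonneg h h3 hx (Real.exp_pos u)
  rw [Real.log_exp] at h1
  push_cast at h1
  set W := assocFun (hatMatrix τ x) (Real.exp u)
  have h4 : (L * p * u - Real.log (hatMatrix τ x (L * p))) * (l / L) ≤ W * (l / L) :=
    mul_le_mul_of_nonneg_right h1 (by positivity)
  have h5 : W * (l / L) ≤ W := mul_le_of_le_one_right h2 ((div_le_one hL0).2 hL)
  have h6 : L * p * u * (l / L) = l * p * u := by field_simp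
  rw [sub_mul, h6] at h4
  linarith

lemma natPow_self_le (p : ℕ) : (p : ℝ) ^ p ≤ Real.exp 1 ^ p * p ! := by
  have := Real.pow_div_factorial_le_exp (p : ℝ) (by positivity) p
  rwa [div_le_iff₀ (by positivity), ← Real.exp_one_pow] at this

/-- The weight matrix of `ω_{T̂^x}` is dominated by the matrix `T̂`. -/
lemma exists_weightMatrix_assocFun_le {τ : ℝ → ℝ} (h : IsNormalizedWeight τ) (h3 : Omega3 τ)
    {x l : ℝ} (hx : 0 < x) (hl : 0 < l) :
    ∃ y : ℝ, 0 < y ∧ ∃ b : ℝ, 0 < b ∧ ∀ p : ℕ,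
      weightMatrix (assocFun (hatMatrix τ x)) l p ≤ b ^ p * hatMatrix τ y p := by
  obtain ⟨L, hL⟩ := exists_nat_ge l
  have hL0 : (0 : ℝ) < L := hl.trans_le hL
  refine ⟨x * L, by positivity, L * Real.exp 1, by positivity, fun p => ?_⟩
  have h1 : weightMatrix (assocFun (hatMatrix τ x)) l p
      ≤ Real.exp (1 / L * Real.log (hatMatrix τ x (L * p))) := by
    rw [weightMatrix, Real.exp_le_exp]
    calc 1 / l * youngConj (assocFun (hatMatrix τ x)) (l * p)
        ≤ 1 / l * (l / L * Real.log (hatMatrix τ x (L * p))) :=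
          mul_le_mul_of_nonneg_left (ciSup_le (mul_sub_assocFun_le h h3 hx hl hL p))
            (by positivity)
      _ = _ := by field_simp
  have h2 : Real.log (hatMatrix τ x (L * p))
      ≤ L * (p * Real.log (L * p)) + 1 / x * youngConj τ (x * L * p) := by
    rw [hatMatrix, weightMatrix, Real.log_mul (by positivity) (Real.exp_pos _).ne', Real.log_exp]
    have h4 : ((L * p)! : ℝ) ≤ ((L * p : ℕ) : ℝ) ^ (L * p) := by
      exact_mod_cast Nat.factorial_le_pow (L * p)
    have h5 := Real.log_le_log (by positivity) h4
    rw [Real.log_pow] at h5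
    push_cast at h5 ⊢
    rw [mul_assoc x]
    linarith
  have h6 : Real.exp (p * Real.log (L * p)) = (L * p : ℝ) ^ p := by
    rcases Nat.eq_zero_or_pos p with rfl | hp
    · simp
    · rw [Real.exp_nat_mul, Real.exp_log (by positivity)]
  calc weightMatrix (assocFun (hatMatrix τ x)) l p
      ≤ Real.exp (1 / L * (L * (p * Real.log (L * p)) + 1 / x * youngConj τ (x * L * p))) :=
        h1.trans (Real.exp_le_exp.2 (mul_le_mul_of_nonneg_left h2 (by positivity)))
    _ = Real.exp (p * Real.log (L * p) + 1 / (x * L) * youngConj τ (x * L * p)) := by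
        congr 1; field_simp
    _ = (L * p : ℝ) ^ p * weightMatrix τ (x * L) p := by rw [Real.exp_add, h6, weightMatrix]
    _ ≤ (L * Real.exp 1) ^ p * p ! * weightMatrix τ (x * L) p := by
        refine mul_le_mul_of_nonneg_right ?_ (weightMatrix_pos _ _ _).le
        rw [mul_pow, mul_pow, mul_assoc]
        exact mul_le_mul_of_nonneg_left (natPow_self_le p) (by positivity)
    _ = _ := by rw [hatMatrix, mul_assoc]

/-- The matrix `T̂` is dominated by the weight matrix of `ω_{T̂^x}`. -/
lemma exists_hatMatrix_le {τ : ℝ → ℝ} (h : IsNormalizedWeight τ) (h3 : Omega3 τ)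
    {x y b : ℝ} (hx : 0 < x) (hy : 0 < y) (hb : 0 < b) :
    ∃ l : ℝ, 0 < l ∧ ∃ C : ℝ, 0 < C ∧ ∀ p : ℕ,
      b ^ p * hatMatrix τ y p ≤ C * weightMatrix (assocFun (hatMatrix τ x)) l p := by
  -- The first entry makes `(l p + 1)^p` dominate `b^p p! e^p`; the second gives `y ≤ x l`, hence
  -- `T^y ≤ T^{x l}`.
  set l := max (b * Real.exp 1) (y / x) with hl_def
  have hl : 0 < l := lt_of_lt_of_le (by positivity) (le_max_left _ _)
  refine ⟨l, hl, Real.exp (1 / l), Real.exp_pos _, fun p => ?_⟩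
  have hyl : y ≤ x * l := by
    have : y / x ≤ l := le_max_right _ _
    rwa [div_le_iff₀' hx] at this
  set W := assocFun (hatMatrix τ x) with hW
  have hbdd : BddAbove (Set.range fun u : ℝ => l * p * u - W (Real.exp u)) := by
    obtain ⟨L, hL⟩ := exists_nat_ge l
    refine ⟨l / L * Real.log (hatMatrix τ x (L * p)), ?_⟩
    rintro _ ⟨u, rfl⟩
    exact mul_sub_assocFun_le h h3 hx hl hL p u
  -- This is the value of `r` in `assocFun_le`. The `+ 1` keeps it positive at `p = 0` and costs
  -- only the constant `exp (1 / l)`.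
  have hP : (0 : ℝ) < l * p + 1 := by positivity
  have h1 : youngConj τ (x * l * p) ≤ x * (youngConj W (l * p)
      - l * p * Real.log (l * p + 1) + (l * p + 1)) := by
    refine ciSup_le fun u => ?_
    have h2 := le_ciSup hbdd (u + Real.log (l * p + 1))
    have h4 := assocFun_le h.toIsWeight h3 hx (Real.exp_pos (u + Real.log (l * p + 1))) hP
    have h5 : Real.exp (u + Real.log (l * p + 1)) / (l * p + 1) = Real.exp u := by
      rw [Real.exp_add, Real.exp_log hP, mul_div_cancel_right₀ _ hP.ne']
    rw [h5] at h4
    have h6 : l * p * u - τ (Real.exp u) / x ≤ youngConj W (l * p)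
      - l * p * Real.log (l * p + 1) + (l * p + 1) := by
      have : l * p * (u + Real.log (l * p + 1)) - W (Real.exp (u + Real.log (l * p + 1)))
        ≤ youngConj W (l * p) := h2
      linarith
    calc x * l * p * u - τ (Real.exp u) = x * (l * p * u - τ (Real.exp u) / x) := by field_simp
      _ ≤ _ := mul_le_mul_of_nonneg_left h6 hx.le
  have h7 : weightMatrix τ (x * l) p
      ≤ weightMatrix W l p * (Real.exp (-(p * Real.log (l * p + 1))) * Real.exp (p + 1 / l)) := by
    rw [weightMatrix, weightMatrix, ← Real.exp_add, ← Real.exp_add, Real.exp_le_exp]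
    calc 1 / (x * l) * youngConj τ (x * l * p) ≤ 1 / (x * l) * (x * (youngConj W (l * p)
          - l * p * Real.log (l * p + 1) + (l * p + 1))) :=
          mul_le_mul_of_nonneg_left h1 (by positivity)
      _ = _ := by field_simp; ring
  have h8 : Real.exp (-(p * Real.log (l * p + 1))) = ((l * p + 1) ^ p)⁻¹ := by
    rw [Real.exp_neg, Real.exp_nat_mul, Real.exp_log hP]
  have h9 : Real.exp (p + 1 / l) = Real.exp 1 ^ p * Real.exp (1 / l) := by
    rw [Real.exp_add, Real.exp_one_pow]
  have h10 : b ^ p * (p ! : ℝ) * Real.exp 1 ^ p ≤ (l * p + 1) ^ p := by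
    have h11 : (p ! : ℝ) ≤ (p : ℝ) ^ p := by exact_mod_cast Nat.factorial_le_pow p
    calc b ^ p * (p ! : ℝ) * Real.exp 1 ^ p ≤ b ^ p * (p : ℝ) ^ p * Real.exp 1 ^ p := by gcongr
      _ = (b * Real.exp 1 * p) ^ p := by rw [← mul_pow, ← mul_pow]; ring
      _ ≤ (l * p + 1) ^ p := by
        have : b * Real.exp 1 ≤ l := le_max_left _ _
        have : b * Real.exp 1 * p ≤ l * p := by gcongr
        gcongr
        linarith
  calc b ^ p * hatMatrix τ y p = b ^ p * p ! * weightMatrix τ y p := by rw [hatMatrix, mul_assoc]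
    _ ≤ b ^ p * p ! * (weightMatrix W l p * (((l * p + 1) ^ p)⁻¹ * (Real.exp 1 ^ p *
          Real.exp (1 / l)))) := by
        rw [← h8, ← h9]
        exact mul_le_mul_of_nonneg_left ((weightMatrix_mono h.toIsWeight h3 hy hyl p).trans h7)
          (by positivity)
    _ = (b ^ p * p ! * Real.exp 1 ^ p) * ((l * p + 1) ^ p)⁻¹
          * (Real.exp (1 / l) * weightMatrix W l p) := by ring
    _ ≤ (l * p + 1) ^ p * ((l * p + 1) ^ p)⁻¹ * (Real.exp (1 / l) * weightMatrix W l p) := by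
        have := (weightMatrix_pos W l p).le
        gcongr
    _ = _ := by rw [mul_inv_cancel₀ (by positivity), one_mul]

lemma holoBounded_mono (γ : ℝ) {v v' : ℕ → ℝ} {C : ℝ} (hv : ∀ p, 0 ≤ v p)
    (h : ∀ p, v p ≤ C * v' p) : holoBounded γ v ≤ holoBounded γ v' := by
  rintro f ⟨hf, D, hD⟩
  refine ⟨hf, max D 0 * C, fun w p => (hD w p).trans ?_⟩
  calc D * v p ≤ max D 0 * v p := mul_le_mul_of_nonneg_right (le_max_left _ _) (hv p)
    _ ≤ max D 0 * (C * v' p) := mul_le_mul_of_nonneg_left (h p) (le_max_right _ _)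
    _ = _ := by ring

/-- `A_{T̂}(S_γ) = A_{ω}(S_γ)` for `ω = ω_{T̂^x}`. -/
theorem classOfMatrix_hatMatrix {τ : ℝ → ℝ} (h : IsNormalizedWeight τ) (h3 : Omega3 τ)
    {x : ℝ} (hx : 0 < x) (γ : ℝ) :
    classOfMatrix γ (hatMatrix τ) = classOfWeight γ (assocFun (hatMatrix τ x)) := by
  refine Set.Subset.antisymm ?_ ?_
  · rintro f ⟨y, hy, b, hb, hf⟩
    obtain ⟨l, hl, C, hC, hle⟩ := exists_hatMatrix_le h h3 hx hy hb
    exact ⟨l, hl, holoBounded_mono γ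
      (fun p => (mul_pos (pow_pos hb p) (hatMatrix_pos τ y p)).le) hle hf⟩
  · rintro f ⟨l, hl, hf⟩
    obtain ⟨y, hy, b, hb, hle⟩ := exists_weightMatrix_assocFun_le h h3 hx hl
    exact ⟨y, hy, b, hb, holoBounded_mono γ (C := 1) (fun p => (weightMatrix_pos _ l p).le)
      (fun p => by simpa using hle p) hf⟩

/-! ### Growth of the weight -/

/-- Iterating the growth property at some `g > γ` shows that `τ` grows along powers of `q = K ^ g`
at most like powers of `K`, that is, with exponent `1 / g`. Any `a` strictly between `1 / g` and `1
/ γ` leaves room on both sides: `K < q ^ a`, and `a γ' < 1` for some `γ' > γ`. -/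
lemma exists_growth {τ : ℝ → ℝ} (h : IsWeight τ) {γ : ℝ} (hγ : 0 < γ)
    (hγτ : ENNReal.ofReal γ < growthIndex τ) :
    ∃ a γ' q K C : ℝ, 0 < a ∧ γ < γ' ∧ a * γ' < 1 ∧ 1 < q ∧ 0 ≤ K ∧ K < q ^ a ∧ 0 < C ∧
      ∀ t : ℝ, 1 ≤ t → ∀ j : ℕ, τ (t * q ^ (j + 1)) ≤ C * (τ t + 1) * K ^ j := by
  obtain ⟨g, hg⟩ := lt_iSup_iff.1 hγτ
  obtain ⟨⟨hg0, K, hK, hlim⟩, hgγ⟩ := lt_iSup_iff.1 hg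
  rw [ENNReal.ofReal_lt_ofReal_iff hg0] at hgγ
  have hK0 : 0 < K := one_pos.trans hK
  set q := K ^ g with hq
  have hq1 : 1 < q := Real.one_lt_rpow hK hg0
  obtain ⟨t₀, ht₀⟩ := eventually_atTop.1
    ((eventually_lt_of_limsup_lt hlim).and (h.tendsto_atTop.eventually_gt_atTop 0))
  set B := τ (q * max t₀ 0) with hB
  have hB0 : 0 ≤ B := h.nonneg (by positivity)
  have hstep : ∀ t : ℝ, 1 ≤ t → τ (q * t) ≤ K * τ t + B := by
    intro t ht
    have htn : 0 ≤ τ t := h.nonneg (by linarith)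
    rcases le_total t₀ t with h1 | h1
    · obtain ⟨h2, h3⟩ := ht₀ t h1
      rw [ENNReal.ofReal_lt_ofReal_iff hK0, div_lt_iff₀ h3] at h2
      linarith
    · have : τ (q * t) ≤ B := by
        apply h.monotoneOn
        · exact Set.mem_Ici.2 (by positivity)
        · exact Set.mem_Ici.2 (by positivity)
        · exact mul_le_mul_of_nonneg_left (h1.trans (le_max_left _ _)) (by positivity)
      have : 0 ≤ K * τ t := by positivity
      linarith
  -- This shift makes the affine recursion homogeneous: `K s + B + B' = K (s + B')`.
  set B' := B / (K - 1) with hB'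
  have hB'0 : 0 ≤ B' := div_nonneg hB0 (by linarith)
  have hBB : B = B' * (K - 1) := by rw [hB', div_mul_cancel₀ _ (by linarith)]
  have hiter : ∀ t : ℝ, 1 ≤ t → ∀ j : ℕ, τ (t * q ^ j) + B' ≤ K ^ j * (τ t + B') := by
    intro t ht j
    induction j with
    | zero => simp
    | succ j ih =>
      have h1 := hstep (t * q ^ j) (one_le_mul_of_one_le_of_one_le ht (one_le_pow₀ hq1.le))
      rw [pow_succ, ← mul_assoc, mul_comm _ q, pow_succ' K, mul_assoc]
      have := mul_le_mul_of_nonneg_left ih hK0.le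
      nlinarith
  -- Here `1 / a` is the midpoint of `γ` and `g`, and `γ'` is the midpoint of `γ` and `1 / a`.
  refine ⟨2 / (γ + g), (3 * γ + g) / 4, q, K, K * (1 + B'), by positivity, by linarith, ?_, hq1,
    hK0.le, ?_, by positivity, fun t ht j => ?_⟩
  · rw [div_mul_div_comm, div_lt_one (by positivity)]
    linarith
  · rw [hq, ← Real.rpow_mul hK0.le]
    nth_rewrite 1 [← Real.rpow_one K]
    refine Real.rpow_lt_rpow_of_exponent_lt hK ?_
    rw [mul_div_assoc', lt_div_iff₀ (by positivity)]
    linarith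
  · have h1 := hiter t ht (j + 1)
    have h2 : 0 ≤ τ t := h.nonneg (by linarith)
    have h3 : τ t + B' ≤ (1 + B') * (τ t + 1) := by nlinarith
    calc τ (t * q ^ (j + 1)) ≤ K ^ (j + 1) * (τ t + B') := by linarith
      _ ≤ K ^ (j + 1) * ((1 + B') * (τ t + 1)) := by gcongr
      _ = _ := by ring

/-! ### A transition kernel -/

/-- In the coordinate `w = log z`, the function `ζ ^ a / (1 + ζ ^ a)` of `ζ = 1 / z`. -/
def transitionKernel (a : ℝ) (w : ℂ) : ℂ := (1 + Complex.exp (a * w))⁻¹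

lemma norm_exp_ofReal_mul (a : ℝ) (w : ℂ) : ‖Complex.exp (a * w)‖ = Real.exp (a * w.re) := by
  rw [Complex.norm_exp]; simp

lemma le_re_one_add_exp {a c : ℝ} {w : ℂ} (hc1 : c ≤ 1) (hc : c ≤ Real.cos (a * w.im)) :
    c * (1 + Real.exp (a * w.re)) ≤ (1 + Complex.exp (a * w)).re := by
  have : (1 + Complex.exp (a * w)).re = 1 + Real.exp (a * w.re) * Real.cos (a * w.im) := by
    simp [Complex.exp_re]
  rw [this]
  nlinarith [Real.exp_pos (a * w.re)]

lemma le_norm_one_add_exp {a c : ℝ} {w : ℂ} (hc1 : c ≤ 1) (hc : c ≤ Real.cos (a * w.im)) :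
    c * (1 + Real.exp (a * w.re)) ≤ ‖1 + Complex.exp (a * w)‖ :=
  (le_re_one_add_exp hc1 hc).trans (Complex.re_le_norm _)

lemma one_add_exp_ne_zero {a c : ℝ} {w : ℂ} (hc0 : 0 < c) (hc1 : c ≤ 1)
    (hc : c ≤ Real.cos (a * w.im)) : 1 + Complex.exp (a * w) ≠ 0 := by
  rw [← norm_pos_iff]
  exact lt_of_lt_of_le (by positivity) (le_norm_one_add_exp hc1 hc)

lemma norm_transitionKernel_le {a c : ℝ} {w : ℂ} (hc0 : 0 < c) (hc1 : c ≤ 1)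
    (hc : c ≤ Real.cos (a * w.im)) :
    ‖transitionKernel a w‖ ≤ c⁻¹ * Real.exp (-(a * w.re)) := by
  rw [transitionKernel, norm_inv, Real.exp_neg, ← mul_inv]
  refine inv_anti₀ (by positivity) (le_trans ?_ (le_norm_one_add_exp hc1 hc))
  gcongr
  linarith

/-- Inversion preserves a cone about the positive axis, because `Re (1 / v) = Re v / |v|²`. Sums of
such kernels with nonnegative weights therefore undergo no serious cancellation. -/
lemma le_re_transitionKernel {a c : ℝ} {w : ℂ} (hc0 : 0 < c) (hc1 : c ≤ 1)
    (hc : c ≤ Real.cos (a * w.im)) :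
    c * ‖transitionKernel a w‖ ≤ (transitionKernel a w).re := by
  have h0 := norm_pos_iff.2 (one_add_exp_ne_zero hc0 hc1 hc)
  rw [transitionKernel, norm_inv, Complex.inv_re, Complex.normSq_eq_norm_sq, ← div_eq_mul_inv,
    div_le_div_iff₀ h0 (by positivity), pow_two, ← mul_assoc]
  refine mul_le_mul_of_nonneg_right (le_trans ?_ (le_re_one_add_exp hc1 hc)) h0.le
  refine mul_le_mul_of_nonneg_left ((norm_add_le _ _).trans ?_) hc0.le
  rw [norm_exp_ofReal_mul, norm_one]

lemma half_le_re_transitionKernel {a c : ℝ} {w : ℂ} (ha : 0 ≤ a) (hc0 : 0 < c) (hc1 : c ≤ 1)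
    (hc : c ≤ Real.cos (a * w.im)) (hw : w.re ≤ 0) : c / 2 ≤ (transitionKernel a w).re := by
  refine le_trans ?_ (le_re_transitionKernel hc0 hc1 hc)
  rw [div_eq_mul_inv]
  refine mul_le_mul_of_nonneg_left ?_ hc0.le
  rw [transitionKernel, norm_inv]
  refine inv_anti₀ (norm_pos_iff.2 (one_add_exp_ne_zero hc0 hc1 hc)) ((norm_add_le _ _).trans ?_)
  rw [norm_exp_ofReal_mul, norm_one]
  have : Real.exp (a * w.re) ≤ 1 := Real.exp_le_one_iff.2 (mul_nonpos_of_nonneg_of_nonpos ha hw)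
  linarith

lemma cos_le_cos_of_mem_sector {a γ : ℝ} (ha : 0 < a) (haγ : a * γ < 1) {w : ℂ}
    (hw : w ∈ sector γ) : Real.cos (a * γ * Real.pi / 2) ≤ Real.cos (a * w.im) := by
  have hw' : |w.im| < γ * Real.pi / 2 := hw
  rw [← Real.cos_abs (a * w.im), abs_mul, abs_of_pos ha]
  refine Real.cos_le_cos_of_nonneg_of_le_pi (by positivity) ?_ ?_
  · nlinarith [Real.pi_pos]
  · nlinarith

/-! ### The exponent of a flat function starting at a given scale -/

/-- The `j`-th term of `flatExponent`. -/
def flatTerm (τ : ℝ → ℝ) (a q t : ℝ) (j : ℕ) (w : ℂ) : ℂ :=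
  ((τ (t * q ^ (j + 1)) - τ (t * q ^ j) : ℝ) : ℂ) *
    transitionKernel a (w + (Real.log (t * q ^ j) : ℝ))

/-- A holomorphic function on a sector, given in the coordinate `w = log z`, whose real part grows
like `τ (1 / |z|) - τ t` for `|z| < 1 / t` and which is small for `|z| > 1 / t`. -/
def flatExponent (τ : ℝ → ℝ) (a q t : ℝ) (w : ℂ) : ℂ := ∑' j : ℕ, flatTerm τ a q t j w

/-- The hypotheses on the parameters of `flatExponent`. -/
structure FlatData (τ : ℝ → ℝ) (a γ q K C c : ℝ) : Prop where
  weight : IsWeight τ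
  a_pos : 0 < a
  one_lt_q : 1 < q
  K_nonneg : 0 ≤ K
  K_lt : K < q ^ a
  C_pos : 0 < C
  growth : ∀ t : ℝ, 1 ≤ t → ∀ j : ℕ, τ (t * q ^ (j + 1)) ≤ C * (τ t + 1) * K ^ j
  c_pos : 0 < c
  c_le_one : c ≤ 1
  le_cos : ∀ w ∈ sector γ, c ≤ Real.cos (a * w.im)

namespace FlatData

variable {τ : ℝ → ℝ} {a γ q K C c : ℝ}

lemma diff_nonneg (h : FlatData τ a γ q K C c) {t : ℝ} (ht : 1 ≤ t) (j : ℕ) :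
    0 ≤ τ (t * q ^ (j + 1)) - τ (t * q ^ j) := by
  have hq := h.one_lt_q
  have hq0 : 0 < q := one_pos.trans hq
  have ht0 : 0 < t := by linarith
  refine sub_nonneg.2 (h.weight.monotoneOn (Set.mem_Ici.2 (by positivity))
    (Set.mem_Ici.2 (by positivity)) ?_)
  exact mul_le_mul_of_nonneg_left (pow_le_pow_right₀ hq.le (Nat.le_succ j)) ht0.le

lemma diff_le (h : FlatData τ a γ q K C c) {t : ℝ} (ht : 1 ≤ t) (j : ℕ) :
    τ (t * q ^ (j + 1)) - τ (t * q ^ j) ≤ C * (τ t + 1) * K ^ j := by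
  have hq0 : 0 < q := one_pos.trans h.one_lt_q
  have ht0 : 0 < t := by linarith
  have := h.weight.nonneg (t := t * q ^ j) (by positivity)
  linarith [h.growth t ht j]

lemma le_cos_shift (h : FlatData τ a γ q K C c) {w : ℂ} (hw : w ∈ sector γ) (s : ℝ) :
    c ≤ Real.cos (a * (w + (s : ℂ)).im) := by
  simpa using h.le_cos w hw

/-- The increment of `τ` contributes `K^j` and the decay of the kernel at scale `t q^j` contributes
`q^{-aj}`, so the series is geometric with ratio `K / q ^ a < 1`. -/
lemma norm_flatTerm_le (h : FlatData τ a γ q K C c) {t : ℝ} (ht : 1 ≤ t) {w : ℂ}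
    (hw : w ∈ sector γ) (j : ℕ) :
    ‖flatTerm τ a q t j w‖
      ≤ C * (τ t + 1) * c⁻¹ * Real.exp (-(a * (w.re + Real.log t))) * (K / q ^ a) ^ j := by
  have hq0 : 0 < q := one_pos.trans h.one_lt_q
  have ht0 : 0 < t := by linarith
  have hc0 := h.c_pos
  have hK := h.K_nonneg
  have hτ := h.weight.nonneg ht0.le
  have hC := h.C_pos
  have h1 := norm_transitionKernel_le h.c_pos h.c_le_one (h.le_cos_shift hw (Real.log (t * q ^ j)))
  have h2 : Real.exp (-(a * (w + (Real.log (t * q ^ j) : ℂ)).re))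
      = Real.exp (-(a * (w.re + Real.log t))) * ((q ^ a) ^ j)⁻¹ := by
    rw [← Real.rpow_natCast (q ^ a) j, ← Real.rpow_mul hq0.le, Real.rpow_def_of_pos hq0,
      ← Real.exp_neg, ← Real.exp_add, Complex.add_re, Complex.ofReal_re,
      Real.log_mul ht0.ne' (by positivity), Real.log_pow]
    congr 1
    ring
  rw [h2] at h1
  rw [flatTerm, norm_mul, Complex.norm_real, Real.norm_of_nonneg (h.diff_nonneg ht j), div_pow]
  calc _ ≤ (C * (τ t + 1) * K ^ j) *
        (c⁻¹ * (Real.exp (-(a * (w.re + Real.log t))) * ((q ^ a) ^ j)⁻¹)) :=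
        mul_le_mul (h.diff_le ht j) h1 (norm_nonneg _) (by positivity)
    _ = _ := by ring

lemma ratio_nonneg (h : FlatData τ a γ q K C c) : 0 ≤ K / q ^ a :=
  div_nonneg h.K_nonneg (Real.rpow_nonneg (one_pos.trans h.one_lt_q).le _)

lemma ratio_lt_one (h : FlatData τ a γ q K C c) : K / q ^ a < 1 :=
  (div_lt_one (Real.rpow_pos_of_pos (one_pos.trans h.one_lt_q) _)).2 h.K_lt

lemma summable_norm_flatTerm (h : FlatData τ a γ q K C c) {t : ℝ} (ht : 1 ≤ t) {w : ℂ}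
    (hw : w ∈ sector γ) : Summable fun j => ‖flatTerm τ a q t j w‖ :=
  Summable.of_nonneg_of_le (fun _ => norm_nonneg _) (h.norm_flatTerm_le ht hw)
    ((summable_geometric_of_lt_one h.ratio_nonneg h.ratio_lt_one).mul_left _)

lemma norm_flatExponent_le (h : FlatData τ a γ q K C c) {t : ℝ} (ht : 1 ≤ t) {w : ℂ}
    (hw : w ∈ sector γ) :
    ‖flatExponent τ a q t w‖ ≤ C * c⁻¹ * (1 - K / q ^ a)⁻¹ * (τ t + 1) *
      Real.exp (-(a * (w.re + Real.log t))) := by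
  have hs := (hasSum_geometric_of_lt_one h.ratio_nonneg h.ratio_lt_one).mul_left
    (C * (τ t + 1) * c⁻¹ * Real.exp (-(a * (w.re + Real.log t))))
  refine (tsum_of_norm_bounded hs (h.norm_flatTerm_le ht hw)).trans (le_of_eq ?_)
  ring

lemma le_re_flatTerm (h : FlatData τ a γ q K C c) {t : ℝ} (ht : 1 ≤ t) {w : ℂ}
    (hw : w ∈ sector γ) (j : ℕ) : c * ‖flatTerm τ a q t j w‖ ≤ (flatTerm τ a q t j w).re := by
  have h1 := le_re_transitionKernel h.c_pos h.c_le_one (h.le_cos_shift hw (Real.log (t * q ^ j)))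
  rw [flatTerm, norm_mul, Complex.norm_real, Real.norm_of_nonneg (h.diff_nonneg ht j),
    Complex.re_ofReal_mul]
  calc _ = (τ (t * q ^ (j + 1)) - τ (t * q ^ j)) *
      (c * ‖transitionKernel a (w + (Real.log (t * q ^ j) : ℂ))‖) := by ring
    _ ≤ _ := mul_le_mul_of_nonneg_left h1 (h.diff_nonneg ht j)

lemma re_flatTerm_nonneg (h : FlatData τ a γ q K C c) {t : ℝ} (ht : 1 ≤ t) {w : ℂ}
    (hw : w ∈ sector γ) (j : ℕ) : 0 ≤ (flatTerm τ a q t j w).re :=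
  (mul_nonneg h.c_pos.le (norm_nonneg _)).trans (h.le_re_flatTerm ht hw j)

lemma le_re_flatExponent (h : FlatData τ a γ q K C c) {t : ℝ} (ht : 1 ≤ t) {w : ℂ}
    (hw : w ∈ sector γ) : c * ‖flatExponent τ a q t w‖ ≤ (flatExponent τ a q t w).re := by
  have hs := h.summable_norm_flatTerm ht hw
  rw [flatExponent, Complex.re_tsum hs.of_norm]
  calc _ ≤ c * ∑' j, ‖flatTerm τ a q t j w‖ :=
        mul_le_mul_of_nonneg_left (norm_tsum_le_tsum_norm hs) h.c_pos.le
    _ = ∑' j, c * ‖flatTerm τ a q t j w‖ := tsum_mul_left.symm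
    _ ≤ _ := (hs.mul_left c).tsum_le_tsum (h.le_re_flatTerm ht hw)
        (Complex.hasSum_re hs.of_norm.hasSum).summable

/-- The kernels at scales `t q^j ≤ 1 / |z|` have real part at least `c / 2`, and their weights
telescope to at least `τ (1 / |z|) - τ t`. The other terms have nonnegative real part. -/
lemma sub_le_re_flatExponent (h : FlatData τ a γ q K C c) {t : ℝ} (ht : 1 ≤ t) {w : ℂ}
    (hw : w ∈ sector γ) (hwt : t ≤ Real.exp (-w.re)) :
    c / 2 * (τ (Real.exp (-w.re)) - τ t) ≤ (flatExponent τ a q t w).re := by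
  have hq0 : 0 < q := one_pos.trans h.one_lt_q
  have ht0 : 0 < t := by linarith
  obtain ⟨J, hJ1, hJ2⟩ := exists_nat_pow_near ((one_le_div ht0).2 hwt) h.one_lt_q
  rw [le_div_iff₀' ht0] at hJ1
  rw [div_lt_iff₀' ht0] at hJ2
  have hs := h.summable_norm_flatTerm ht hw
  rw [flatExponent, Complex.re_tsum hs.of_norm]
  refine le_trans ?_ ((Complex.hasSum_re hs.of_norm.hasSum).summable.sum_le_tsum
    (Finset.range (J + 1)) fun j _ => h.re_flatTerm_nonneg ht hw j)
  have h1 : τ (Real.exp (-w.re)) ≤ τ (t * q ^ (J + 1)) :=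
    h.weight.monotoneOn (Set.mem_Ici.2 (Real.exp_pos _).le) (Set.mem_Ici.2 (by positivity)) hJ2.le
  have h2 := Finset.sum_range_sub (fun j => τ (t * q ^ j)) (J + 1)
  simp only [pow_zero, mul_one] at h2
  have hc := h.c_pos
  calc c / 2 * (τ (Real.exp (-w.re)) - τ t) ≤ c / 2 * (τ (t * q ^ (J + 1)) - τ t) := by gcongr
    _ = ∑ j ∈ Finset.range (J + 1), c / 2 * (τ (t * q ^ (j + 1)) - τ (t * q ^ j)) := by
        rw [← h2, Finset.mul_sum]
    _ ≤ _ := by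
        refine Finset.sum_le_sum fun j hj => ?_
        rw [flatTerm, Complex.re_ofReal_mul, mul_comm (c / 2)]
        refine mul_le_mul_of_nonneg_left ?_ (h.diff_nonneg ht j)
        refine half_le_re_transitionKernel h.a_pos.le h.c_pos h.c_le_one (h.le_cos_shift hw _) ?_
        rw [Complex.add_re, Complex.ofReal_re]
        have h3 : t * q ^ j ≤ Real.exp (-w.re) := le_trans (mul_le_mul_of_nonneg_left
          (pow_le_pow_right₀ h.one_lt_q.le (Nat.lt_succ_iff.1 (Finset.mem_range.1 hj))) ht0.le) hJ1
        have := (Real.log_le_iff_le_exp (by positivity)).2 h3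
        linarith

lemma differentiableOn_flatTerm (h : FlatData τ a γ q K C c) (t : ℝ) (j : ℕ) :
    DifferentiableOn ℂ (flatTerm τ a q t j) (sector γ) := by
  intro w hw
  refine DifferentiableAt.differentiableWithinAt ?_
  unfold flatTerm transitionKernel
  refine DifferentiableAt.const_mul (DifferentiableAt.inv (by fun_prop) ?_) _
  exact one_add_exp_ne_zero h.c_pos h.c_le_one (h.le_cos_shift hw _)

lemma differentiableOn_flatExponent (h : FlatData τ a γ q K C c) {t : ℝ} (ht : 1 ≤ t) :
    DifferentiableOn ℂ (flatExponent τ a q t) (sector γ) := by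
  intro w hw
  -- The bound on the terms blows up at the vertex, so uniform convergence holds only where `Re` is
  -- bounded below.
  set U : Set ℂ := sector γ ∩ {v | w.re - 1 < v.re} with hU
  have hUo : IsOpen U := (isOpen_sector γ).inter (isOpen_lt continuous_const Complex.continuous_re)
  have hwU : w ∈ U := ⟨hw, by simp⟩
  have ha := h.a_pos
  have hC := h.C_pos
  have hc := h.c_pos
  have hτ := h.weight.nonneg (t := t) (by linarith)
  have hd : DifferentiableOn ℂ (flatExponent τ a q t) U := by
    refine Complex.differentiableOn_tsum_of_summable_norm (u := fun j => C * (τ t + 1) * c⁻¹ *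
      Real.exp (-(a * (w.re - 1 + Real.log t))) * (K / q ^ a) ^ j)
      ((summable_geometric_of_lt_one h.ratio_nonneg h.ratio_lt_one).mul_left _)
      (fun j => (h.differentiableOn_flatTerm t j).mono Set.inter_subset_left) hUo ?_
    intro j v hv
    refine (h.norm_flatTerm_le ht hv.1 j).trans ?_
    have h1 : w.re - 1 < v.re := hv.2
    have h2 := h.ratio_nonneg
    gcongr
  exact (hd.differentiableAt (hUo.mem_nhds hwU)).differentiableWithinAt

end FlatData

/-! ### Cutoffs of exponential type -/

/-- The normalized incomplete gamma function `1 - exp (-h) ∑_{k < n} h ^ k / k!`. -/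
def gammaCutoff (n : ℕ) (h : ℂ) : ℂ :=
  1 - Complex.exp (-h) * ∑ k ∈ Finset.range n, h ^ k / (k ! : ℂ)

lemma exp_sub_sum_le {x : ℝ} (hx : 0 ≤ x) (n : ℕ) :
    Real.exp x - ∑ k ∈ Finset.range n, x ^ k / (k ! : ℝ) ≤ x ^ n / n ! * Real.exp x := by
  have h1 : HasSum (fun k : ℕ => x ^ k / (k ! : ℝ)) (Real.exp x) := by
    rw [Real.exp_eq_exp_ℝ]
    exact NormedSpace.expSeries_div_hasSum_exp x
  refine hasSum_le (fun k => ?_) ((hasSum_nat_add_iff' n).2 h1) (h1.mul_left (x ^ n / n !))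
  rw [div_mul_div_comm, ← pow_add, add_comm n k]
  refine div_le_div_of_nonneg_left (by positivity) (by positivity) ?_
  have := Nat.le_of_dvd (Nat.factorial_pos _) (Nat.factorial_mul_factorial_dvd_factorial_add n k)
  rw [add_comm k n]
  exact_mod_cast this

/-- The Taylor remainder of `exp` gives `|h|^n / n!` times `exp |h|`. With `|h| ≤ X r`, the factor
`X^n / n!` is at most `exp X`, leaving the pure power `r^n`, uniformly in `n`. -/
lemma norm_gammaCutoff_le {n : ℕ} {h : ℂ} {X r : ℝ} (h0 : 0 ≤ h.re) (hr0 : 0 ≤ r) (hr1 : r ≤ 1)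
    (hX : 0 ≤ X) (hh : ‖h‖ ≤ X * r) : ‖gammaCutoff n h‖ ≤ r ^ n * Real.exp (2 * X) := by
  have h1 : gammaCutoff n h
      = Complex.exp (-h) * (Complex.exp h - ∑ k ∈ Finset.range n, h ^ k / (k ! : ℂ)) := by
    rw [gammaCutoff, mul_sub, ← Complex.exp_add, neg_add_cancel, Complex.exp_zero]
  have h2 : ‖Complex.exp h - ∑ k ∈ Finset.range n, h ^ k / (k ! : ℂ)‖
      ≤ ‖h‖ ^ n / n ! * Real.exp ‖h‖ := by
    exact (Complex.norm_exp_sub_sum_le_exp_norm_sub_sum h n).trans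
      (exp_sub_sum_le (norm_nonneg h) n)
  have h3 : ‖Complex.exp (-h)‖ ≤ 1 := by
    rw [Complex.norm_exp, Real.exp_le_one_iff]; simpa using h0
  have hXr : X * r ≤ X := mul_le_of_le_one_right hX hr1
  calc ‖gammaCutoff n h‖ ≤ 1 * (‖h‖ ^ n / n ! * Real.exp ‖h‖) := by
        rw [h1, norm_mul]
        exact mul_le_mul h3 h2 (norm_nonneg _) zero_le_one
    _ ≤ (X * r) ^ n / n ! * Real.exp X := by
        rw [one_mul]
        gcongr
        exact hh.trans hXr
    _ = r ^ n * (X ^ n / n !) * Real.exp X := by rw [mul_pow]; ring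
    _ ≤ r ^ n * Real.exp X * Real.exp X := by
        gcongr
        exact Real.pow_div_factorial_le_exp X hX n
    _ = _ := by rw [mul_assoc, ← Real.exp_add, two_mul]

/-- Weighting the exponential sum by `(2 / c)^n` lowers its growth to `exp (c |h| / 2)`, and in the
cone this uses up only half of the decay `exp (-Re h)`. -/
lemma norm_one_sub_gammaCutoff_le {n : ℕ} {h : ℂ} {c : ℝ} (hc0 : 0 < c) (hc1 : c ≤ 1)
    (hh : c * ‖h‖ ≤ h.re) :
    ‖1 - gammaCutoff n h‖ ≤ (2 / c) ^ n * Real.exp (-(h.re / 2)) := by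
  have h1 : ∑ k ∈ Finset.range n, ‖h‖ ^ k / (k ! : ℝ) ≤ (2 / c) ^ n * Real.exp (c / 2 * ‖h‖) := by
    calc ∑ k ∈ Finset.range n, ‖h‖ ^ k / (k ! : ℝ)
        ≤ ∑ k ∈ Finset.range n, (2 / c) ^ n * ((c / 2 * ‖h‖) ^ k / (k ! : ℝ)) := by
          refine Finset.sum_le_sum fun k hk => ?_
          have h2 : ‖h‖ ^ k = (2 / c) ^ k * (c / 2 * ‖h‖) ^ k := by
            rw [← mul_pow]; congr 1; field_simp
          rw [h2, mul_div_assoc]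
          refine mul_le_mul_of_nonneg_right ?_ (by positivity)
          refine pow_le_pow_right₀ ?_ (Finset.mem_range.1 hk).le
          rw [le_div_iff₀ hc0]; linarith
      _ = (2 / c) ^ n * ∑ k ∈ Finset.range n, (c / 2 * ‖h‖) ^ k / (k ! : ℝ) := by
          rw [Finset.mul_sum]
      _ ≤ _ := by
          gcongr
          exact Real.sum_le_exp_of_nonneg (by positivity) n
  have h2 : ‖∑ k ∈ Finset.range n, h ^ k / (k ! : ℂ)‖
      ≤ ∑ k ∈ Finset.range n, ‖h‖ ^ k / (k ! : ℝ) := by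
    refine (norm_sum_le _ _).trans (le_of_eq ?_)
    simp
  rw [gammaCutoff, sub_sub_cancel, norm_mul, Complex.norm_exp, Complex.neg_re]
  calc _ ≤ Real.exp (-h.re) * ((2 / c) ^ n * Real.exp (c / 2 * ‖h‖)) := by
        gcongr; exact h2.trans h1
    _ = (2 / c) ^ n * Real.exp (-h.re + c / 2 * ‖h‖) := by rw [Real.exp_add]; ring
    _ ≤ _ := by
        gcongr
        linarith

lemma differentiable_gammaCutoff (n : ℕ) : Differentiable ℂ (gammaCutoff n) := by
  unfold gammaCutoff
  fun_prop

set_option maxHeartbeats 1000000 in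
/-- Holomorphic cutoffs adapted to the sequence `T^y`. -/
lemma FlatData.exists_cutoffs {τ : ℝ → ℝ} {a γ q K C c : ℝ} (h : FlatData τ a γ q K C c)
    (hn : IsNormalizedWeight τ) (h3 : Omega3 τ) {y : ℝ} (hy : 0 < y) :
    ∃ D B y₁ : ℝ, 1 ≤ D ∧ 0 < B ∧ 0 < y₁ ∧ ∃ χ : ℕ → ℂ → ℂ,
      (∀ p, DifferentiableOn ℂ (χ p) (sector γ)) ∧
      ∀ w ∈ sector γ, ∀ p N : ℕ,
        (N ≤ p → weightMatrix τ y p * Real.exp w.re ^ p * ‖χ p w‖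
          ≤ B * D ^ p * (weightMatrix τ y₁ N * Real.exp w.re ^ N)) ∧
        (p < N → weightMatrix τ y p * Real.exp w.re ^ p * ‖1 - χ p w‖
          ≤ B * D ^ p * (weightMatrix τ y₁ N * Real.exp w.re ^ N)) := by
  have hw' := h.weight
  have hC := h.C_pos
  have hc := h.c_pos
  have hc1 := h.c_le_one
  have ha := h.a_pos
  choose t ht1 ht using exists_weightMatrix_le hn hy
  set C' := C * c⁻¹ * (1 - K / q ^ a)⁻¹ with hC'
  have hC'0 : 0 < C' := by
    have := h.ratio_lt_one
    have : 0 < 1 - K / q ^ a := by linarith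
    positivity
  -- The first bound makes the loss `exp (2 X)` in `norm_gammaCutoff_le` cost at most half of the
  -- decay `exp (-τ(t_p) / y)`. The second ensures `M' ≤ 1 / y`, so that this decay also pays for
  -- `exp (M' τ(t_p))`.
  set M := min (1 / (4 * y * C')) (1 / y) with hM
  have hM0 : 0 < M := lt_min (by positivity) (by positivity)
  have hMC : 2 * (M * C') ≤ 1 / (2 * y) := by
    have : M ≤ 1 / (4 * y * C') := min_le_left _ _
    calc 2 * (M * C') ≤ 2 * (1 / (4 * y * C') * C') := by gcongr
      _ = _ := by field_simp; norm_num
  set M' := M * c / 4 with hM'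
  have hM'0 : 0 < M' := by positivity
  have hM'y : M' ≤ 1 / y := by
    have h1 : M ≤ 1 / y := min_le_right _ _
    have h2 : M * c ≤ M := mul_le_of_le_one_right hM0.le hc1
    rw [hM']
    linarith
  -- With `a m ≥ 1`, a zero of order `m p` turns the decay `(t|z|)^{-a}` of the exponent into at
  -- least `(t|z|)^{-p}`.
  obtain ⟨m, hm⟩ := exists_nat_ge (1 / a)
  have hma : 1 ≤ a * m := by rwa [div_le_iff₀' ha] at hm
  set D := (2 / c) ^ m with hD
  have h2c : 1 ≤ 2 / c := by rw [le_div_iff₀ hc]; linarith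
  have hD1 : 1 ≤ D := one_le_pow₀ h2c
  -- The remaining decay rates are `1 / (2 y)`, `1 / y` and `M'`, according to the case; all are at
  -- least `1 / y₁`.
  set y₁ := max (2 * y) (1 / M') with hy₁
  have hy₁0 : 0 < y₁ := lt_of_lt_of_le (by positivity) (le_max_left _ _)
  set B := 4 * Real.exp (2 * (M * C')) with hB
  have hB4 : 4 ≤ B := by
    have : 1 ≤ Real.exp (2 * (M * C')) := Real.one_le_exp (by positivity)
    linarith
  have hlow : ∀ (s k : ℝ) (N : ℕ), 0 < s → 1 / y₁ ≤ k →
      s ^ N * Real.exp (-(k * τ s)) ≤ weightMatrix τ y₁ N := by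
    intro s k N hs hk
    refine le_trans ?_ (pow_mul_exp_le_weightMatrix hw' h3 hy₁0 hs N)
    have := mul_le_mul_of_nonneg_right hk (hw'.nonneg hs.le)
    rw [one_div_mul_eq_div] at this
    gcongr
  have hk1 : 1 / y₁ ≤ 1 / (2 * y) := one_div_le_one_div_of_le (by positivity) (le_max_left _ _)
  have hk2 : 1 / y₁ ≤ 1 / y := hk1.trans (one_div_le_one_div_of_le hy (by linarith))
  have hk3 : 1 / y₁ ≤ M' := (one_div_le hy₁0 hM'0).2 (le_max_right _ _)
  refine ⟨D, B, y₁, hD1, by linarith, hy₁0,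
    fun p w => gammaCutoff (m * p) (M * flatExponent τ a q (t p) w), fun p => ?_, ?_⟩
  · exact (differentiable_gammaCutoff _).comp_differentiableOn
      ((h.differentiableOn_flatExponent (ht1 p)).const_mul _)
  intro w hw p N
  set H := flatExponent τ a q (t p) w with hH
  set Z := Real.exp w.re with hZ
  have hZ0 : 0 < Z := Real.exp_pos _
  have ht0 : 0 < t p := by linarith [ht1 p]
  have hτ0 : 0 ≤ τ (t p) := hw'.nonneg ht0.le
  have hDp : 1 ≤ D ^ p := one_le_pow₀ hD1
  have hTp : weightMatrix τ y p * Z ^ p ≤ 2 * (t p * Z) ^ p * Real.exp (-(1 / y * τ (t p))) := by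
    rw [one_div_mul_eq_div, mul_pow]
    calc _ ≤ 2 * (t p ^ p * Real.exp (-(τ (t p) / y))) * Z ^ p := by gcongr; exact ht p
      _ = _ := by ring
  have hre : c * ‖(M : ℂ) * H‖ ≤ ((M : ℂ) * H).re := by
    rw [norm_mul, Complex.norm_real, Real.norm_of_nonneg hM0.le, Complex.re_ofReal_mul]
    have := mul_le_mul_of_nonneg_left (h.le_re_flatExponent (ht1 p) hw) hM0.le
    rw [← hH] at this
    linarith
  have hre0 : 0 ≤ ((M : ℂ) * H).re := (mul_nonneg hc.le (norm_nonneg _)).trans hre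
  have hone : ‖1 - gammaCutoff (m * p) (M * H)‖
      ≤ D ^ p * Real.exp (-(((M : ℂ) * H).re / 2)) := by
    rw [hD, ← pow_mul]
    exact norm_one_sub_gammaCutoff_le hc hc1 hre
  have hone' : ‖1 - gammaCutoff (m * p) (M * H)‖ ≤ D ^ p := by
    refine hone.trans (mul_le_of_le_one_right (by positivity) ?_)
    rw [Real.exp_le_one_iff]
    linarith
  have hRN : 0 ≤ weightMatrix τ y₁ N * Z ^ N :=
    mul_nonneg (weightMatrix_pos _ _ _).le (by positivity)
  -- the scale of the cutoff is compared with that of the point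
  have hfar : 1 ≤ t p * Z → weightMatrix τ y p * Z ^ p * ‖gammaCutoff (m * p) (M * H)‖
      ≤ B * D ^ p * (weightMatrix τ y₁ N * Z ^ N) := by
    intro hX
    have hs : 0 ≤ w.re + Real.log (t p) := by
      have := Real.log_nonneg hX
      rw [Real.log_mul ht0.ne' hZ0.ne', hZ, Real.log_exp] at this
      linarith
    set r := Real.exp (-(a * (w.re + Real.log (t p)))) with hr
    have hr1 : r ≤ 1 := by
      rw [hr, Real.exp_le_one_iff]
      have := mul_nonneg ha.le hs
      linarith
    have hnorm : ‖(M : ℂ) * H‖ ≤ M * C' * (τ (t p) + 1) * r := by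
      rw [norm_mul, Complex.norm_real, Real.norm_of_nonneg hM0.le]
      have := mul_le_mul_of_nonneg_left (h.norm_flatExponent_le (ht1 p) hw) hM0.le
      refine this.trans (le_of_eq ?_)
      rw [hC', hr]
      ring
    have h1 := norm_gammaCutoff_le (n := m * p) hre0 (Real.exp_pos _).le hr1
      (show 0 ≤ M * C' * (τ (t p) + 1) by positivity) hnorm
    have h2 : r ^ (m * p) ≤ ((t p * Z) ^ p)⁻¹ := by
      have h4 : (t p * Z) ^ p = Real.exp (p * (w.re + Real.log (t p))) := by
        rw [Real.exp_nat_mul, Real.exp_add, Real.exp_log ht0, mul_comm Z]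
      rw [h4, ← Real.exp_neg, hr, ← Real.exp_nat_mul, Real.exp_le_exp]
      have h5 : 0 ≤ (a * m - 1) * (p * (w.re + Real.log (t p))) :=
        mul_nonneg (by linarith) (mul_nonneg (by positivity) hs)
      have h6 : ((m * p : ℕ) : ℝ) * -(a * (w.re + Real.log (t p)))
          = -(p * (w.re + Real.log (t p)))
            - (a * m - 1) * (p * (w.re + Real.log (t p))) := by push_cast; ring
      linarith
    have h6 : Real.exp (2 * (M * C' * (τ (t p) + 1)))
        ≤ Real.exp (2 * (M * C')) * Real.exp (1 / (2 * y) * τ (t p)) := by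
      rw [← Real.exp_add, Real.exp_le_exp]
      have h5 := mul_le_mul_of_nonneg_right hMC hτ0
      have h7 : 2 * (M * C' * (τ (t p) + 1)) = 2 * (M * C') + 2 * (M * C') * τ (t p) := by ring
      linarith
    have h7 : Real.exp (-(1 / y * τ (t p))) * Real.exp (1 / (2 * y) * τ (t p))
        = Real.exp (-(1 / (2 * y) * τ (t p))) := by
      rw [← Real.exp_add]
      congr 1
      field_simp
      ring
    have h8 : Real.exp (-(1 / (2 * y) * τ (t p))) ≤ weightMatrix τ y₁ N * Z ^ N := by
      calc Real.exp (-(1 / (2 * y) * τ (t p)))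
          ≤ (t p * Z) ^ N * Real.exp (-(1 / (2 * y) * τ (t p))) :=
            le_mul_of_one_le_left (Real.exp_pos _).le (one_le_pow₀ hX)
        _ = t p ^ N * Real.exp (-(1 / (2 * y) * τ (t p))) * Z ^ N := by ring
        _ ≤ _ := by gcongr; exact hlow _ _ N ht0 hk1
    have hX0 : 0 < (t p * Z) ^ p := by positivity
    calc weightMatrix τ y p * Z ^ p * ‖gammaCutoff (m * p) (M * H)‖
        ≤ 2 * (t p * Z) ^ p * Real.exp (-(1 / y * τ (t p))) * (((t p * Z) ^ p)⁻¹ *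
          (Real.exp (2 * (M * C')) * Real.exp (1 / (2 * y) * τ (t p)))) := by
          refine mul_le_mul hTp (h1.trans ?_) (norm_nonneg _) (by positivity)
          gcongr
      _ = 2 * Real.exp (2 * (M * C')) *
          (Real.exp (-(1 / y * τ (t p))) * Real.exp (1 / (2 * y) * τ (t p))) := by
          field_simp
      _ ≤ 2 * Real.exp (2 * (M * C')) * (weightMatrix τ y₁ N * Z ^ N) := by rw [h7]; gcongr
      _ ≤ B * D ^ p * (weightMatrix τ y₁ N * Z ^ N) := by
          refine mul_le_mul_of_nonneg_right ?_ hRN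
          have h9 := Real.exp_pos (2 * (M * C'))
          have : B ≤ B * D ^ p := le_mul_of_one_le_right (by linarith) hDp
          linarith
  have hmid : (t p * Z) ^ p ≤ (t p * Z) ^ N → weightMatrix τ y p * Z ^ p
      ≤ 2 * (weightMatrix τ y₁ N * Z ^ N) := by
    intro hX
    calc weightMatrix τ y p * Z ^ p ≤ 2 * (t p * Z) ^ p * Real.exp (-(1 / y * τ (t p))) := hTp
      _ ≤ 2 * (t p * Z) ^ N * Real.exp (-(1 / y * τ (t p))) := by gcongr
      _ = 2 * (t p ^ N * Real.exp (-(1 / y * τ (t p))) * Z ^ N) := by ring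
      _ ≤ _ := by gcongr; exact hlow _ _ N ht0 hk2
  -- When `t_p |z|` lies on the side of `1` where `(t_p |z|)^p ≤ (t_p |z|)^N`, the bound `hmid` and
  -- a crude bound on the cutoff suffice. Only `χ_p` far out and `1 - χ_p` near the vertex need real
  -- decay.
  refine ⟨fun hNp => ?_, fun hpN => ?_⟩
  · rcases le_total 1 (t p * Z) with hX | hX
    · exact hfar hX
    · have h1 : ‖gammaCutoff (m * p) (M * H)‖ ≤ 2 * D ^ p := by
        have h2 : gammaCutoff (m * p) (M * H) = 1 - (1 - gammaCutoff (m * p) (M * H)) := by ring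
        rw [h2]
        refine (norm_sub_le _ _).trans ?_
        rw [norm_one]
        linarith
      calc _ ≤ 2 * (weightMatrix τ y₁ N * Z ^ N) * (2 * D ^ p) :=
            mul_le_mul (hmid (pow_le_pow_of_le_one (by positivity) hX hNp)) h1 (norm_nonneg _)
              (by positivity)
        _ = 4 * D ^ p * (weightMatrix τ y₁ N * Z ^ N) := by ring
        _ ≤ _ := by gcongr
  · rcases le_total 1 (t p * Z) with hX | hX
    · calc _ ≤ 2 * (weightMatrix τ y₁ N * Z ^ N) * D ^ p :=
            mul_le_mul (hmid (pow_le_pow_right₀ hX hpN.le)) hone' (norm_nonneg _) (by positivity)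
        _ = 2 * D ^ p * (weightMatrix τ y₁ N * Z ^ N) := by ring
        _ ≤ _ := by gcongr; linarith
    · have hZinv : Real.exp (-w.re) = Z⁻¹ := Real.exp_neg _
      have htZ : t p ≤ Real.exp (-w.re) := by
        rwa [hZinv, ← one_div, le_div_iff₀ hZ0]
      have h1 : M' * (τ Z⁻¹ - τ (t p)) ≤ ((M : ℂ) * H).re / 2 := by
        have h2 := mul_le_mul_of_nonneg_left (h.sub_le_re_flatExponent (ht1 p) hw htZ) hM0.le
        rw [Complex.re_ofReal_mul]
        rw [hZinv] at h2
        rw [hM']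
        linarith
      have h2 : Real.exp (-(1 / y * τ (t p))) * Real.exp (-(((M : ℂ) * H).re / 2))
          ≤ Real.exp (-(M' * τ Z⁻¹)) := by
        rw [← Real.exp_add, Real.exp_le_exp]
        have := mul_le_mul_of_nonneg_right hM'y hτ0
        linarith
      calc _ ≤ 2 * (t p * Z) ^ p * Real.exp (-(1 / y * τ (t p))) *
            (D ^ p * Real.exp (-(((M : ℂ) * H).re / 2))) :=
            mul_le_mul hTp hone (norm_nonneg _) (by positivity)
        _ = 2 * (t p * Z) ^ p * D ^ p * (Real.exp (-(1 / y * τ (t p))) *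
            Real.exp (-(((M : ℂ) * H).re / 2))) := by ring
        _ ≤ 2 * 1 * D ^ p * Real.exp (-(M' * τ Z⁻¹)) := by
            gcongr
            exact pow_le_one₀ (by positivity) hX
        -- Near the vertex the supremum defining `T^{y₁}_N` is tested at `1 / |z|` instead of `t_p`.
        _ = 2 * D ^ p * (Z⁻¹ ^ N * Real.exp (-(M' * τ Z⁻¹)) * Z ^ N) := by
            rw [mul_right_comm (Z⁻¹ ^ N), ← mul_pow, inv_mul_cancel₀ hZ0.ne']
            ring
        _ ≤ B * D ^ p * (weightMatrix τ y₁ N * Z ^ N) := by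
            have := hlow Z⁻¹ M' N (by positivity) hk3
            gcongr
            linarith

/-! ### Cauchy estimates on sectors -/

lemma surfaceDeriv_iterate_congr {γ : ℝ} {F G : ℂ → ℂ} (h : Set.EqOn F G (sector γ)) (n : ℕ) :
    Set.EqOn (surfaceDeriv^[n] F) (surfaceDeriv^[n] G) (sector γ) := by
  induction n with
  | zero => exact h
  | succ n ih =>
    intro w hw
    simp only [Function.iterate_succ_apply', surfaceDeriv]
    rw [(ih.eventuallyEq_of_mem ((isOpen_sector γ).mem_nhds hw)).deriv_eq]

lemma iterDeriv_restrict {γ : ℝ} (F : ℂ → ℂ) (n : ℕ) (w : sector γ) :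
    iterDeriv n (fun v : sector γ => F v) w = (surfaceDeriv^[n] F) w :=
  surfaceDeriv_iterate_congr (fun v hv => extendZero_apply (fun v : sector γ => F v) ⟨v, hv⟩) n w.2

lemma sector_mono {γ γ' : ℝ} (h : γ ≤ γ') : sector γ ⊆ sector γ' := by
  intro w hw
  have h1 : |LogSurface.argument w| < γ * Real.pi / 2 := hw
  have : γ * Real.pi / 2 ≤ γ' * Real.pi / 2 := by
    have := Real.pi_pos
    gcongr
  exact lt_of_lt_of_le h1 this

lemma exists_radius {γ γ' : ℝ} (h : γ < γ') :
    ∃ ε : ℝ, 0 < ε ∧ ε ≤ 1 / 4 ∧ ∀ w ∈ sector γ, ∀ z : ℂ, ‖z‖ < 2 * ε →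
      w + Complex.log (1 + z) ∈ sector γ' := by
  -- The argument changes by at most `|log (1 + z)| ≤ 3/2 |z|`, which is less than `(γ' - γ) π / 2`.
  refine ⟨min (1 / 4) ((γ' - γ) / 4), ?_, min_le_left _ _, fun w hw z hz => ?_⟩
  · exact lt_min (by norm_num) (by linarith)
  · have h1 : ‖z‖ < 1 / 2 := by linarith [min_le_left (1 / 4) ((γ' - γ) / 4)]
    have h2 : ‖z‖ < (γ' - γ) / 2 := by linarith [min_le_right (1 / 4) ((γ' - γ) / 4)]
    have h3 := Complex.norm_log_one_add_half_le_self h1.le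
    have h4 := (Complex.abs_im_le_norm (Complex.log (1 + z))).trans h3
    have hw' : |w.im| < γ * Real.pi / 2 := hw
    change |(w + Complex.log (1 + z)).im| < γ' * Real.pi / 2
    rw [Complex.add_im]
    refine (abs_add_le _ _).trans_lt ?_
    nlinarith [Real.pi_gt_three, norm_nonneg z]

lemma one_add_mem_slitPlane {z : ℂ} (hz : ‖z‖ < 1) : 1 + z ∈ Complex.slitPlane :=
  Complex.mem_slitPlane_of_norm_lt_one hz

/-- The composed function is `ζ ↦ f(z₀ (1 + ζ))` with `z₀ = exp w`, so its derivatives are `z₀^n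
f^{(n)}`. This carries Cauchy's estimates in a plane disc over to the surface. -/
lemma iteratedDeriv_comp_log {γ : ℝ} {F : ℂ → ℂ} (hF : DifferentiableOn ℂ F (sector γ)) {w : ℂ}
    {r : ℝ} (hr : r ≤ 1) (hw : ∀ z : ℂ, ‖z‖ < r → w + Complex.log (1 + z) ∈ sector γ) (n : ℕ) :
    Set.EqOn (iteratedDeriv n fun z => F (w + Complex.log (1 + z)))
      (fun z => Complex.exp (n * w) * (surfaceDeriv^[n] F) (w + Complex.log (1 + z)))
      (Metric.ball 0 r) := by
  induction n with
  | zero => intro z _; simp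
  | succ n ih =>
    intro z hz
    have hz' : ‖z‖ < r := by simpa using hz
    have h1 := hw z hz'
    have hs := one_add_mem_slitPlane (hz'.trans_le hr)
    have h2 : HasDerivAt (surfaceDeriv^[n] F) (deriv (surfaceDeriv^[n] F)
        (w + Complex.log (1 + z))) (w + Complex.log (1 + z)) :=
      ((differentiableOn_iterate hF n).differentiableAt
        ((isOpen_sector γ).mem_nhds h1)).hasDerivAt
    have h3 : HasDerivAt (fun z => w + Complex.log (1 + z)) (1 / (1 + z)) z :=
      (((hasDerivAt_id z).const_add 1).clog hs).const_add w
    have h6 : HasDerivAt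
        (fun z => Complex.exp (n * w) * (surfaceDeriv^[n] F) (w + Complex.log (1 + z)))
        (Complex.exp (n * w) * (deriv (surfaceDeriv^[n] F) (w + Complex.log (1 + z))
          * (1 / (1 + z)))) z := (h2.comp z h3).const_mul _
    rw [iteratedDeriv_succ,
      (ih.eventuallyEq_of_mem (Metric.isOpen_ball.mem_nhds hz)).deriv_eq, h6.deriv]
    dsimp only
    rw [Function.iterate_succ_apply', surfaceDeriv, neg_add, Complex.exp_add,
      Complex.exp_neg (Complex.log _), Complex.exp_log (Complex.slitPlane_ne_zero hs)]
    have h4 : Complex.exp (((n + 1 : ℕ) : ℂ) * w) = Complex.exp (n * w) * Complex.exp w := by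
      rw [← Complex.exp_add]; congr 1; push_cast; ring
    have h5 : Complex.exp w * Complex.exp (-w) = 1 := by
      rw [← Complex.exp_add, add_neg_cancel, Complex.exp_zero]
    rw [h4, one_div]
    linear_combination (-(Complex.exp (n * w) * (1 + z)⁻¹ *
      deriv (surfaceDeriv^[n] F) (w + Complex.log (1 + z)))) * h5

/-- Cauchy estimates: a bound by `|z| ^ N` on a larger sector gives bounds for the derivatives. -/
lemma norm_surfaceDeriv_iterate_le {γ γ' ε : ℝ} (hε : 0 < ε) (hε' : ε ≤ 1 / 4)
    (hsec : ∀ w ∈ sector γ, ∀ z : ℂ, ‖z‖ < 2 * ε → w + Complex.log (1 + z) ∈ sector γ')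
    {F : ℂ → ℂ} (hF : DifferentiableOn ℂ F (sector γ')) {Q : ℝ} {N : ℕ}
    (hQ : ∀ w ∈ sector γ', ‖F w‖ ≤ Q * Real.exp w.re ^ N) (n : ℕ) {w : ℂ} (hw : w ∈ sector γ) :
    ‖(surfaceDeriv^[n] F) w‖ * Real.exp w.re ^ n
      ≤ n ! * (Q * (2 * Real.exp w.re) ^ N) / ε ^ n := by
  have hsub : Metric.closedBall (0 : ℂ) ε ⊆ Metric.ball 0 (2 * ε) :=
    Metric.closedBall_subset_ball (by linarith)
  have hd : DifferentiableOn ℂ (fun z => F (w + Complex.log (1 + z))) (Metric.ball 0 (2 * ε)) := by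
    intro z hz
    have hz' : ‖z‖ < 2 * ε := by simpa using hz
    have hs := one_add_mem_slitPlane (hz'.trans_le (by linarith : 2 * ε ≤ 1))
    have h1 := (hF.differentiableAt ((isOpen_sector γ').mem_nhds (hsec w hw z hz')))
    have h3 : HasDerivAt (fun z => w + Complex.log (1 + z)) (1 / (1 + z)) z :=
      (((hasDerivAt_id z).const_add 1).clog hs).const_add w
    exact (h1.comp z h3.differentiableAt).differentiableWithinAt
  have hQ0 : 0 ≤ Q := by
    have h0 : ‖(0 : ℂ)‖ < 2 * ε := by simpa using hε
    have := (norm_nonneg _).trans (hQ _ (hsec w hw 0 h0))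
    exact nonneg_of_mul_nonneg_left this (by positivity)
  have hbound : ∀ z ∈ Metric.sphere (0 : ℂ) ε,
      ‖F (w + Complex.log (1 + z))‖ ≤ Q * (2 * Real.exp w.re) ^ N := by
    intro z hz
    have hz' : ‖z‖ = ε := by simpa using hz
    have hs := one_add_mem_slitPlane (z := z) (by rw [hz']; linarith)
    refine (hQ _ (hsec w hw z (by linarith))).trans ?_
    have h1 : Real.exp (w + Complex.log (1 + z)).re = Real.exp w.re * ‖1 + z‖ := by
      rw [Complex.add_re, Real.exp_add, Complex.log_re,
        Real.exp_log (norm_pos_iff.2 (Complex.slitPlane_ne_zero hs))]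
    have h2 : ‖1 + z‖ ≤ 2 := by
      refine (norm_add_le _ _).trans ?_
      rw [norm_one, hz']
      linarith
    rw [h1, mul_comm 2]
    gcongr
  have h := Complex.norm_iteratedDeriv_le_of_forall_mem_sphere_norm_le n hε
    (hd.diffContOnCl_ball hsub) hbound
  rw [iteratedDeriv_comp_log hF (by linarith) (hsec w hw) n (Metric.mem_ball_self (by linarith))] at h
  have h1 : ‖Complex.exp (n * w)‖ = Real.exp w.re ^ n := by
    rw [Complex.exp_nat_mul, norm_pow, Complex.norm_exp]
  rw [mul_comm ‖_‖]
  simpa only [add_zero, Complex.log_one, norm_mul, h1] using h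

/-! ### Derivatives of monomials -/

lemma surfaceDeriv_iterate_exp (α : ℂ) (n : ℕ) :
    surfaceDeriv^[n] (fun w => Complex.exp (α * w))
      = fun w => (∏ i ∈ Finset.range n, (α - i)) * Complex.exp ((α - n) * w) := by
  induction n with
  | zero => simp
  | succ n ih =>
    rw [Function.iterate_succ_apply', ih]
    funext w
    have h1 : HasDerivAt (fun w => Complex.exp ((α - n) * w))
        (Complex.exp ((α - n) * w) * (α - n)) w := by
      simpa using ((hasDerivAt_id w).const_mul (α - n)).cexp
    rw [surfaceDeriv, (h1.const_mul _).deriv, Finset.prod_range_succ]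
    have h2 : Complex.exp ((α - (n + 1 : ℕ)) * w)
        = Complex.exp (-w) * Complex.exp ((α - n) * w) := by
      rw [← Complex.exp_add]; congr 1; push_cast; ring
    rw [h2]
    ring

lemma surfaceDeriv_iterate_monomial_of_lt {p n : ℕ} (h : p < n) :
    surfaceDeriv^[n] (fun w => Complex.exp (p * w)) = 0 := by
  rw [surfaceDeriv_iterate_exp, Finset.prod_eq_zero (Finset.mem_range.2 h) (sub_self _)]
  funext w
  simp

lemma surfaceDeriv_iterate_monomial_self (p : ℕ) (w : ℂ) :
    (surfaceDeriv^[p] (fun w => Complex.exp (p * w))) w = p ! := by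
  rw [surfaceDeriv_iterate_exp]
  have : (∏ i ∈ Finset.range p, ((p : ℂ) - i)) = p ! := by
    rw [← Nat.descFactorial_self, Nat.descFactorial_eq_prod_range, Nat.cast_prod]
    refine Finset.prod_congr rfl fun i hi => ?_
    rw [Nat.cast_sub (Finset.mem_range.1 hi).le]
  simp [this]

lemma surfaceDeriv_iterate_sub_sum {γ : ℝ} {F : ℂ → ℂ} (hF : DifferentiableOn ℂ F (sector γ))
    (a : ℕ → ℂ) (n k : ℕ) :
    Set.EqOn (surfaceDeriv^[n] (fun w => F w - ∑ p ∈ Finset.range k, a p * Complex.exp (p * w)))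
      (fun w => (surfaceDeriv^[n] F) w
        - ∑ p ∈ Finset.range k, a p * (surfaceDeriv^[n] (fun w => Complex.exp (p * w))) w)
      (sector γ) := by
  induction k with
  | zero => intro w _; simp
  | succ k ih =>
    intro w hw
    have h1 : (fun w => F w - ∑ p ∈ Finset.range (k + 1), a p * Complex.exp (p * w))
        = (fun w => F w - ∑ p ∈ Finset.range k, a p * Complex.exp (p * w))
          + (-a k) • (fun w : ℂ => Complex.exp (k * w)) := by
      funext w
      simp only [Finset.sum_range_succ, Pi.add_apply, Pi.smul_apply, smul_eq_mul]
      ring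
    have hd1 : DifferentiableOn ℂ
        (fun w => F w - ∑ p ∈ Finset.range k, a p * Complex.exp (p * w)) (sector γ) :=
      hF.sub (Differentiable.differentiableOn (by fun_prop))
    have hd2 : DifferentiableOn ℂ ((-a k) • (fun w : ℂ => Complex.exp (k * w))) (sector γ) :=
      Differentiable.differentiableOn (Differentiable.const_smul (by fun_prop) _)
    rw [h1, iterate_add_on hd1 hd2 n hw, Pi.add_apply, ih hw, iterate_smul]
    simp only [Finset.sum_range_succ, Pi.smul_apply, smul_eq_mul]
    ring

/-! ### Functions with an asymptotic expansion -/

/-- The `n`-th derivative kills the polynomial of degree less than `n`. Cauchy's estimate for the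
remainder of order `n` loses exactly the factor `|z|^n` that the remainder provides. -/
lemma norm_iterDeriv_le_of_expansion {γ γ' ε : ℝ} (hγ : γ ≤ γ') (hε : 0 < ε) (hε' : ε ≤ 1 / 4)
    (hsec : ∀ w ∈ sector γ, ∀ z : ℂ, ‖z‖ < 2 * ε → w + Complex.log (1 + z) ∈ sector γ')
    {F : ℂ → ℂ} (hF : DifferentiableOn ℂ F (sector γ')) {a : ℕ → ℂ} {Q : ℕ → ℝ}
    (hQ : ∀ N, ∀ w ∈ sector γ', ‖F w - ∑ p ∈ Finset.range N, a p * Complex.exp (p * w)‖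
      ≤ Q N * Real.exp w.re ^ N) (n : ℕ) (w : sector γ) :
    ‖iterDeriv n (fun v : sector γ => F v) w‖ ≤ n ! * Q n * (2 / ε) ^ n := by
  have hd : DifferentiableOn ℂ (fun w => F w - ∑ p ∈ Finset.range n, a p * Complex.exp (p * w))
      (sector γ') := hF.sub (Differentiable.differentiableOn (by fun_prop))
  have h := norm_surfaceDeriv_iterate_le hε hε' hsec hd (hQ n) n w.2
  rw [surfaceDeriv_iterate_sub_sum hF a n n (sector_mono hγ w.2)] at h
  rw [iterDeriv_restrict]
  have h0 : ∑ p ∈ Finset.range n,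
      a p * (surfaceDeriv^[n] (fun w => Complex.exp (p * w))) (w : ℂ) = 0 :=
    Finset.sum_eq_zero fun p hp => by
      rw [surfaceDeriv_iterate_monomial_of_lt (Finset.mem_range.1 hp)]; simp
  simp only [h0, sub_zero] at h
  refine le_of_mul_le_mul_right (h.trans (le_of_eq ?_))
    (pow_pos (Real.exp_pos (w : ℂ).re) n)
  rw [mul_pow, div_pow]
  ring

/-- Going one order further, to `n + 1`, leaves the constant `n! a_n` and a spare factor `|z|`,
which forces the limit. -/
lemma hasBorelImage_of_expansion {γ γ' ε : ℝ} (hγ : γ ≤ γ') (hε : 0 < ε) (hε' : ε ≤ 1 / 4)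
    (hsec : ∀ w ∈ sector γ, ∀ z : ℂ, ‖z‖ < 2 * ε → w + Complex.log (1 + z) ∈ sector γ')
    {F : ℂ → ℂ} (hF : DifferentiableOn ℂ F (sector γ')) {a : ℕ → ℂ} {Q : ℕ → ℝ}
    (hQ : ∀ N, ∀ w ∈ sector γ', ‖F w - ∑ p ∈ Finset.range N, a p * Complex.exp (p * w)‖
      ≤ Q N * Real.exp w.re ^ N) :
    HasBorelImage (fun v : sector γ => F v) (fun p => p ! * a p) := by
  intro n
  have hd : DifferentiableOn ℂ
      (fun w => F w - ∑ p ∈ Finset.range (n + 1), a p * Complex.exp (p * w))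
      (sector γ') := hF.sub (Differentiable.differentiableOn (by fun_prop))
  have hle : ∀ w : sector γ, ‖iterDeriv n (fun v : sector γ => F v) w - n ! * a n‖
      ≤ n ! * Q (n + 1) * 2 ^ (n + 1) / ε ^ n * LogSurface.modulus w := by
    intro w
    have h := norm_surfaceDeriv_iterate_le hε hε' hsec hd (hQ (n + 1)) n w.2
    rw [surfaceDeriv_iterate_sub_sum hF a n (n + 1) (sector_mono hγ w.2)] at h
    rw [iterDeriv_restrict]
    have h0 : ∑ p ∈ Finset.range n,
        a p * (surfaceDeriv^[n] (fun w => Complex.exp (p * w))) (w : ℂ) = 0 :=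
      Finset.sum_eq_zero fun p hp => by
        rw [surfaceDeriv_iterate_monomial_of_lt (Finset.mem_range.1 hp)]; simp
    simp only [Finset.sum_range_succ, h0, zero_add, surfaceDeriv_iterate_monomial_self] at h
    rw [mul_comm ((n ! : ℕ) : ℂ)]
    refine le_of_mul_le_mul_right (h.trans (le_of_eq ?_))
      (pow_pos (Real.exp_pos (w : ℂ).re) n)
    rw [mul_pow, LogSurface.modulus]
    ring
  rw [tendsto_iff_norm_sub_tendsto_zero]
  refine squeeze_zero (fun _ => norm_nonneg _) hle ?_
  have : Tendsto (fun w : sector γ => LogSurface.modulus w) (atVertex γ) (𝓝 0) := tendsto_comap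
  simpa using this.const_mul (n ! * Q (n + 1) * 2 ^ (n + 1) / ε ^ n)

/-! ### The extension operator -/

/-- Holomorphic cutoffs turning formal power series with coefficients bounded by `h ^ p T p`
into functions whose remainders of order `N` are bounded by `b ^ N T₁ N |z| ^ N`. -/
structure IsCutoffFamily (γ : ℝ) (T T₁ : ℕ → ℝ) (D B : ℝ) (χ : ℕ → ℂ → ℂ) : Prop where
  one_le : 1 ≤ D
  pos : 0 < B
  differentiableOn : ∀ p, DifferentiableOn ℂ (χ p) (sector γ)
  bound : ∀ w ∈ sector γ, ∀ p N : ℕ,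
    (N ≤ p → T p * Real.exp w.re ^ p * ‖χ p w‖ ≤ B * D ^ p * (T₁ N * Real.exp w.re ^ N)) ∧
    (p < N → T p * Real.exp w.re ^ p * ‖1 - χ p w‖ ≤ B * D ^ p * (T₁ N * Real.exp w.re ^ N))

/-- The series `∑ a_p z ^ p χ_p (b z)` in the coordinate `w = log z`. -/
def borelSum (χ : ℕ → ℂ → ℂ) (b : ℝ) (a : ℕ → ℂ) (w : ℂ) : ℂ :=
  ∑' p : ℕ, a p * Complex.exp (p * w) * χ p (w + (Real.log b : ℝ))

lemma add_ofReal_mem_sector {γ : ℝ} {w : ℂ} (hw : w ∈ sector γ) (s : ℝ) :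
    w + (s : ℂ) ∈ sector γ := by
  have hw' : |w.im| < γ * Real.pi / 2 := hw
  change |(w + (s : ℂ)).im| < γ * Real.pi / 2
  simpa using hw'

lemma norm_coeff_mul_le {T : ℕ → ℝ} {A h D B b R : ℝ} {p : ℕ} {α X w : ℂ} (hA : 0 ≤ A) (hh : 0 < h)
    (hD : 1 ≤ D) (hb : b = 2 * h * D) (hα : ‖α‖ ≤ A * (h ^ p * T p))
    (hX : T p * (Real.exp w.re * b) ^ p * ‖X‖ ≤ B * D ^ p * R) :
    ‖α * Complex.exp (p * w) * X‖ ≤ A * B * R * (1 / 2) ^ p := by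
  have hD0 : 0 < D := by linarith
  have hb0 : 0 < b := by rw [hb]; positivity
  have h1 : ‖Complex.exp (p * w)‖ = Real.exp w.re ^ p := by
    rw [Complex.exp_nat_mul, norm_pow, Complex.norm_exp]
  rw [norm_mul, norm_mul, h1]
  calc ‖α‖ * Real.exp w.re ^ p * ‖X‖ ≤ A * (h ^ p * T p) * Real.exp w.re ^ p * ‖X‖ := by gcongr
    _ = A * (h / b) ^ p * (T p * (Real.exp w.re * b) ^ p * ‖X‖) := by
        rw [mul_pow, div_pow]; field_simp
    _ ≤ A * (h / b) ^ p * (B * D ^ p * R) := by gcongr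
    _ = A * B * R * (h / b * D) ^ p := by rw [mul_pow]; ring
    _ = _ := by
        -- The choice `b = 2 h D` turns `h D / b` into the ratio `1 / 2`.
        congr 2
        rw [hb]; field_simp

section BorelSum

variable {γ : ℝ} {T T₁ : ℕ → ℝ} {D B : ℝ} {χ : ℕ → ℂ → ℂ}

lemma exp_re_add_log {b : ℝ} (hb : 0 < b) (w : ℂ) :
    Real.exp (w + (Real.log b : ℝ)).re = Real.exp w.re * b := by
  rw [Complex.add_re, Complex.ofReal_re, Real.exp_add, Real.exp_log hb]

lemma IsCutoffFamily.norm_term_le (hχ : IsCutoffFamily γ T T₁ D B χ) {A h b : ℝ} (hA : 0 ≤ A)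
    (hh : 0 < h) (hb : b = 2 * h * D) {a : ℕ → ℂ} (ha : ∀ p, ‖a p‖ ≤ A * (h ^ p * T p)) {w : ℂ}
    (hw : w ∈ sector γ) {p N : ℕ} (hN : N ≤ p) :
    ‖a p * Complex.exp (p * w) * χ p (w + (Real.log b : ℝ))‖
      ≤ A * B * (T₁ N * (Real.exp w.re * b) ^ N) * (1 / 2) ^ p := by
  have hD := hχ.one_le
  have hb0 : 0 < b := by rw [hb]; positivity
  refine norm_coeff_mul_le hA hh hD hb (ha p) ?_
  rw [← exp_re_add_log hb0]
  exact (hχ.bound _ (add_ofReal_mem_sector hw _) p N).1 hN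

lemma IsCutoffFamily.summable_term (hχ : IsCutoffFamily γ T T₁ D B χ) {A h b : ℝ} (hA : 0 ≤ A)
    (hh : 0 < h) (hb : b = 2 * h * D) {a : ℕ → ℂ} (ha : ∀ p, ‖a p‖ ≤ A * (h ^ p * T p)) {w : ℂ}
    (hw : w ∈ sector γ) :
    Summable fun p : ℕ => a p * Complex.exp (p * w) * χ p (w + (Real.log b : ℝ)) :=
  Summable.of_norm_bounded (summable_geometric_two.mul_left _)
    fun p => hχ.norm_term_le hA hh hb ha hw (Nat.zero_le p)

lemma IsCutoffFamily.differentiableOn_borelSum (hχ : IsCutoffFamily γ T T₁ D B χ) {A h b : ℝ}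
    (hA : 0 ≤ A) (hh : 0 < h) (hb : b = 2 * h * D) {a : ℕ → ℂ}
    (ha : ∀ p, ‖a p‖ ≤ A * (h ^ p * T p)) : DifferentiableOn ℂ (borelSum χ b a) (sector γ) := by
  refine Complex.differentiableOn_tsum_of_summable_norm
    (summable_geometric_two.mul_left (A * B * T₁ 0)) (fun p => ?_) (isOpen_sector γ)
    fun p w hw => by simpa using hχ.norm_term_le hA hh hb ha hw (Nat.zero_le p)
  refine DifferentiableOn.mul (Differentiable.differentiableOn (by fun_prop)) ?_
  exact (hχ.differentiableOn p).comp (Differentiable.differentiableOn (by fun_prop))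
    fun w hw => add_ofReal_mem_sector hw _

/-- Subtracting the polynomial termwise leaves `-(1 - χ_p)` in the terms with `p < N` and `χ_p` in
the others; these are the two cases of the cutoff bound, each summable with ratio `1 / 2`. -/
lemma IsCutoffFamily.norm_borelSum_sub_le (hχ : IsCutoffFamily γ T T₁ D B χ) {A h b : ℝ}
    (hA : 0 ≤ A) (hh : 0 < h) (hb : b = 2 * h * D) {a : ℕ → ℂ}
    (ha : ∀ p, ‖a p‖ ≤ A * (h ^ p * T p)) (N : ℕ) {w : ℂ} (hw : w ∈ sector γ) :
    ‖borelSum χ b a w - ∑ p ∈ Finset.range N, a p * Complex.exp (p * w)‖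
      ≤ 2 * A * B * (b ^ N * T₁ N) * Real.exp w.re ^ N := by
  have hD := hχ.one_le
  have hb0 : 0 < b := by rw [hb]; positivity
  have h1 := (hχ.summable_term hA hh hb ha hw).hasSum
  have h2 : HasSum (fun p => if p ∈ Finset.range N then a p * Complex.exp (p * w) else 0)
      (∑ p ∈ Finset.range N, a p * Complex.exp (p * w)) := by
    have := hasSum_sum_of_ne_finset_zero (s := Finset.range N)
      (f := fun p => if p ∈ Finset.range N then a p * Complex.exp (p * w) else 0)
      (L := SummationFilter.unconditional ℕ) (fun p hp => if_neg hp)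
    rwa [Finset.sum_congr rfl fun p hp => if_pos hp] at this
  have h3 := hasSum_geometric_two.mul_left (A * B * (T₁ N * (Real.exp w.re * b) ^ N))
  refine ((h1.sub h2).norm_le_of_bounded h3 fun p => ?_).trans (le_of_eq ?_)
  · by_cases hp : p ∈ Finset.range N
    · rw [if_pos hp]
      have h4 : a p * Complex.exp (p * w) * χ p (w + (Real.log b : ℝ)) - a p * Complex.exp (p * w)
          = -(a p * Complex.exp (p * w) * (1 - χ p (w + (Real.log b : ℝ)))) := by ring
      rw [h4, norm_neg]
      refine norm_coeff_mul_le hA hh hD hb (ha p) ?_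
      rw [← exp_re_add_log hb0]
      exact (hχ.bound _ (add_ofReal_mem_sector hw _) p N).2 (Finset.mem_range.1 hp)
    · rw [if_neg hp, sub_zero]
      exact hχ.norm_term_le hA hh hb ha hw (by simpa using hp)
  · rw [mul_pow]; ring

end BorelSum

lemma exists_isCutoffFamily {τ : ℝ → ℝ} (hn : IsNormalizedWeight τ) (h3 : Omega3 τ) {γ : ℝ}
    (hγ : 0 < γ) (hγτ : ENNReal.ofReal γ < growthIndex τ) {y : ℝ} (hy : 0 < y) :
    ∃ γ' y₁ D B : ℝ, γ < γ' ∧ 0 < y₁ ∧ ∃ χ : ℕ → ℂ → ℂ,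
      IsCutoffFamily γ' (weightMatrix τ y) (weightMatrix τ y₁) D B χ := by
  obtain ⟨a, γ', q, K, C, ha, hγγ', haγ, hq, hK, hKq, hC, hgrowth⟩ :=
    exists_growth hn.toIsWeight hγ hγτ
  have hγ' : 0 < γ' := hγ.trans hγγ'
  have hflat : FlatData τ a γ' q K C (Real.cos (a * γ' * Real.pi / 2)) :=
    { weight := hn.toIsWeight
      a_pos := ha
      one_lt_q := hq
      K_nonneg := hK
      K_lt := hKq
      C_pos := hC
      growth := hgrowth
      c_pos := by
        refine Real.cos_pos_of_mem_Ioo ⟨?_, ?_⟩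
        · have : 0 < a * γ' * Real.pi / 2 := by positivity
          linarith [Real.pi_pos]
        · nlinarith [Real.pi_pos]
      c_le_one := Real.cos_le_one _
      le_cos := fun w hw => cos_le_cos_of_mem_sector ha haγ hw }
  obtain ⟨D, B, y₁, hD, hB, hy₁, χ, hχ, hbound⟩ := hflat.exists_cutoffs hn h3 hy
  exact ⟨γ', y₁, D, B, hγγ', hy₁, χ, hD, hB, hχ, hbound⟩

/-- Continuous linear right inverses of the Borel map on the spaces `Λ_{ω,l}`. -/
theorem exists_extension {τ : ℝ → ℝ} (hn : IsNormalizedWeight τ) (h3 : Omega3 τ) {γ : ℝ}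
    (hγ : 0 < γ) (hγτ : ENNReal.ofReal γ < growthIndex τ) {x : ℝ} (hx : 0 < x) {l : ℝ}
    (hl : 0 < l) :
    ∃ l₁ : ℝ, 0 < l₁ ∧ ∃ E : SeqSpace (assocFun (hatMatrix τ x)) l →L[ℂ]
        HoloSpace γ (assocFun (hatMatrix τ x)) l₁,
      ∀ a : SeqSpace (assocFun (hatMatrix τ x)) l, HasBorelImage (E a).toFun a.toFun := by
  set ω := assocFun (hatMatrix τ x) with hω
  obtain ⟨y, hy, h, hh, hle⟩ := exists_weightMatrix_assocFun_le hn h3 hx hl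
  obtain ⟨γ', y₁, D, B, hγγ', hy₁, χ, hχ⟩ := exists_isCutoffFamily hn h3 hγ hγτ hy
  obtain ⟨ε, hε, hε', hsec⟩ := exists_radius hγγ'
  have hD := hχ.one_le
  have hB := hχ.pos
  obtain ⟨b, hb⟩ : ∃ b, b = 2 * h * D := ⟨_, rfl⟩
  have hb0 : 0 < b := by rw [hb]; positivity
  -- The geometric factor combines `b` from the remainders with `2 / ε` from Cauchy's estimates on
  -- discs of relative radius `ε`.
  obtain ⟨l₁, hl₁, C, hC, hle₁⟩ := exists_hatMatrix_le hn h3 hx hy₁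
    (show 0 < b * (2 / ε) by positivity)
  have hcoeff : ∀ (a : SeqSpace ω l) (p : ℕ),
      ‖a.toFun p / (p ! : ℂ)‖ ≤ ‖a‖ * (h ^ p * weightMatrix τ y p) := by
    intro a p
    have h1 : ‖a.toFun p‖ ≤ ‖a‖ * weightMatrix ω l p :=
      (div_le_iff₀ (weightMatrix_pos ω l p)).1 (le_ciSup a.bddAbove p)
    have h2 : (0 : ℝ) < p ! := by positivity
    rw [norm_div, Complex.norm_natCast, div_le_iff₀ h2]
    calc ‖a.toFun p‖ ≤ ‖a‖ * (h ^ p * hatMatrix τ y p) :=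
          h1.trans (mul_le_mul_of_nonneg_left (hle p) (norm_nonneg a))
      _ = _ := by rw [hatMatrix]; ring
  set F : SeqSpace ω l → ℂ → ℂ := fun a => borelSum χ b fun p => a.toFun p / (p ! : ℂ) with hF
  have hFd : ∀ a, DifferentiableOn ℂ (F a) (sector γ') := fun a =>
    hχ.differentiableOn_borelSum (norm_nonneg a) hh hb (hcoeff a)
  have hFexp : ∀ a, ∀ N, ∀ w ∈ sector γ',
      ‖F a w - ∑ p ∈ Finset.range N, a.toFun p / (p ! : ℂ) * Complex.exp (p * w)‖
        ≤ 2 * ‖a‖ * B * (b ^ N * weightMatrix τ y₁ N) * Real.exp w.re ^ N := fun a N w hw =>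
    hχ.norm_borelSum_sub_le (norm_nonneg a) hh hb (hcoeff a) N hw
  have hbound : ∀ (a : SeqSpace ω l) (w : sector γ) (n : ℕ),
      ‖iterDeriv n (fun v : sector γ => F a v) w‖
        ≤ 2 * B * C * ‖a‖ * weightMatrix ω l₁ n := by
    intro a w n
    refine (norm_iterDeriv_le_of_expansion hγγ'.le hε hε' hsec (hFd a) (hFexp a) n w).trans ?_
    calc n ! * (2 * ‖a‖ * B * (b ^ n * weightMatrix τ y₁ n)) * (2 / ε) ^ n
        = 2 * B * ‖a‖ * ((b * (2 / ε)) ^ n * hatMatrix τ y₁ n) := by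
          rw [hatMatrix, mul_pow]; ring
      _ ≤ 2 * B * ‖a‖ * (C * weightMatrix ω l₁ n) := by
          exact mul_le_mul_of_nonneg_left (hle₁ n) (by positivity)
      _ = _ := by ring
  have hmem : ∀ a, (fun v : sector γ => F a v) ∈ holoBounded γ (weightMatrix ω l₁) := fun a => by
    refine ⟨?_, _, hbound a⟩
    exact ((hFd a).mono (sector_mono hγγ'.le)).congr
      fun w hw => extendZero_apply (fun v : sector γ => F a v) ⟨w, hw⟩
  have hsummable : ∀ (a : SeqSpace ω l), ∀ w ∈ sector γ', Summable fun p : ℕ =>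
      a.toFun p / (p ! : ℂ) * Complex.exp (p * w) * χ p (w + (Real.log b : ℝ)) := fun a w hw =>
    hχ.summable_term (norm_nonneg a) hh hb (hcoeff a) hw
  let E₀ : SeqSpace ω l →ₗ[ℂ] HoloSpace γ ω l₁ :=
    { toFun := fun a => (⟨fun v => F a v, hmem a⟩ : holoBounded γ (weightMatrix ω l₁))
      map_add' := fun a a' => by
        refine Subtype.ext (funext fun w => ?_)
        have hw := sector_mono hγγ'.le w.2
        refine Eq.trans ?_ ((hsummable a w hw).tsum_add (hsummable a' w hw))
        refine tsum_congr fun p => ?_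
        have : (a + a').toFun p = a.toFun p + a'.toFun p := rfl
        dsimp only
        rw [this]
        ring
      map_smul' := fun k a => by
        refine Subtype.ext (funext fun w => ?_)
        have hw := sector_mono hγγ'.le w.2
        refine Eq.trans ?_ ((hsummable a w hw).tsum_mul_left k)
        refine tsum_congr fun p => ?_
        have : (k • a).toFun p = k * a.toFun p := rfl
        dsimp only
        rw [this]
        ring }
  refine ⟨l₁, hl₁, E₀.mkContinuous (2 * B * C) fun a => ?_, fun a => ?_⟩
  · refine Real.iSup_le (fun q => ?_) (by positivity)
    rw [div_le_iff₀ (weightMatrix_pos _ _ _)]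
    exact hbound a q.1 q.2
  · have h1 := hasBorelImage_of_expansion hγγ'.le hε hε' hsec (hFd a) (hFexp a)
    have h2 : (fun p : ℕ => (p ! : ℂ) * (a.toFun p / (p ! : ℂ))) = a.toFun := by
      funext p
      exact mul_div_cancel₀ _ (by exact_mod_cast (Nat.factorial_pos p).ne')
    rw [h2] at h1
    exact h1

end Ultraholomorphic

end

theorem corollary6p4 (τ : ℝ → ℝ) (hτ : Ultraholomorphic.IsNormalizedWeight τ)
    (hindex : 0 < Ultraholomorphic.growthIndex τ)
    (h3 : Ultraholomorphic.Omega3 τ) (h4 : Ultraholomorphic.Omega4 τ)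
    (γ : ℝ) (hγ : 0 < γ) (hγτ : ENNReal.ofReal γ < Ultraholomorphic.growthIndex τ)
    (x : ℝ) (hx : 0 < x) (ω : ℝ → ℝ)
    (hω : ω = Ultraholomorphic.assocFun (Ultraholomorphic.hatMatrix τ x)) :
    Ultraholomorphic.classOfMatrix γ (Ultraholomorphic.hatMatrix τ)
        = Ultraholomorphic.classOfWeight γ ω ∧
      ∀ l : ℝ, 0 < l → ∃ l₁ : ℝ, 0 < l₁ ∧
        ∃ E : Ultraholomorphic.SeqSpace ω l →L[ℂ] Ultraholomorphic.HoloSpace γ ω l₁,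
          ∀ a : Ultraholomorphic.SeqSpace ω l,
            Ultraholomorphic.HasBorelImage (E a).toFun a.toFun := by
  subst hω
  exact ⟨Ultraholomorphic.classOfMatrix_hatMatrix hτ h3 hx γ,
    fun _ hl => Ultraholomorphic.exists_extension hτ h3 hγ hγτ hx hl⟩
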